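/- Let $\mathcal H=\mathbb C^D$ and $\mathcal K=\mathbb C^d$ with $D,d\ge 1$, and let $\mathcal N:\mathcal B(\mathcal H)\to\mathcal B(\mathcal K\otimes\mathcal H)$ be a completely positive map (not necessarily trace preserving). For $s\in\{1,\dots,d\}$ let $\mathcal M_s[\rho]=\langle s|\,\mathcal N[\rho]\,|s\rangle$, a completely positive self-map of $\mathcal B(\mathcal H)$, and for $b=(s_1,\dots,s_\ell)$ let $\mathcal M_b=\mathcal M_{s_\ell}\circ\cdots\circ\mathcal M_{s_1}$. Let $\sigma=\frac1D\sum_{i,j}|ii\rangle\langle jj|$ be the maximally entangled state on $A\otimes\bar A=\mathcal H\otimes\mathcal H$. Applying $\mathcal N$ successively $\ell$ times to the last factor, starting from $\sigma$, yields an operator $\rho_\ell\ge 0$ on $A\otimes B_1\cdots B_\ell\otimes C$ with $A=C=\mathcal H$ and $B_k=\mathcal K$ (a matrix product density operator). If $\rho_\ell\ne0$, let $\rho_{A\bar BC}$ be the state obtained by measuring $B=B_1\cdots B_\ell$ in the computational basis, i.e. $\sum_b|b\rangle\langle b|_B\,\rho_\ell\,|b\rangle\langle b|_B$ divided by its trace.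 For an outcome $b$ with $p(b)=\mathrm{Tr}(\mathcal M_b[\sigma])\neq0$ let $\rho_{AC,b}=\mathcal M_b[\sigma]/p(b)$, where $\mathcal M_b$ acts on the second factor of $\sigma$. Let $S(\rho)=-\mathrm{Tr}\,\rho\log_2\rho$, let $I(A:C)_b=S(A)+S(C)-S(AC)$ be evaluated in $\rho_{AC,b}$, and let $I(A:C|\bar B)=S(A\bar B)+S(\bar BC)-S(\bar B)-S(A\bar BC)$ be evaluated in $\rho_{A\bar BC}$. Consider the following conditions. 1. There is a number $p\ge1$ such that every $\mathcal M_s$ has $p$ Kraus operators $E^s_1,\dots,E^s_p$ (that is, $\mathcal M_s[X]=\sum_iE^s_iX(E^s_i)^\dagger$) with $E^s_p$ invertible and with $(E^s_p)^{-1}E^s_1,\dots,(E^s_p)^{-1}E^s_{p-1}$ generating $M_D(\mathbb C)$ as a complex algebra. 2. There is a $\xi\in\mathbb N$ such that for every sequence $t=(s_1,\dots,s_\ell)$ of length $\ell\ge\xi$ the map $\mathcal M_t$ is strictly positive: $\mathcal M_t[\rho]$ is positive definite (equivalently $\det\mathcal M_t[\rho]\ne0$) for every density matrix $\rho$ on $\mathcal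 H$. 3. (with constants $c_0,c_1>0$) For every $\ell$ and every outcome $b\in\{1,\dots,d\}^\ell$ with $p(b)\ne0$, $I(A:C)_b\le c_0e^{-c_1\ell}$. 4. (with constants $c_0,c_1>0$) For every $\ell$ with $\rho_\ell\ne0$, $I(A:C|\bar B)\le c_0e^{-c_1\ell}$. Then condition 1 implies condition 2; condition 2 implies that condition 3 holds for some $c_0,c_1>0$ (independent of $\ell$ and $b$); and for all $c_0,c_1>0$, condition 3 with $(c_0,c_1)$ implies condition 4 with the same $(c_0,c_1)$. -/

import Mathlib

open Matrix
open scoped ComplexOrder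

noncomputable section

/-! ### Y-shaped completely positive maps -/

section CP

open scoped Matrix.Norms.L2Operator MatrixOrder CStarAlgebra

/-- Completely positive maps `B(ℋ) → B(𝒦 ⊗ ℋ)` with `ℋ = ℂ^D` and `𝒦 = ℂ^d`. No trace condition is
imposed. The norm and the order on matrices are the operator norm and the Loewner order. -/
abbrev YMap (D d : ℕ) : Type :=
  Matrix (Fin D) (Fin D) ℂ →CP Matrix (Fin d × Fin D) (Fin d × Fin D) ℂ

/-- The linear map underlying `N`. -/
def YMap.lin {D d : ℕ} (N : YMap D d) :
    Matrix (Fin D) (Fin D) ℂ →ₗ[ℂ] Matrix (Fin d × Fin D) (Fin d × Fin D) ℂ :=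
  N.toLinearMap

end CP

/-- Linear self-maps of `B(ℂ^D)`. -/
abbrev SelfMap (D : ℕ) : Type :=
  Matrix (Fin D) (Fin D) ℂ →ₗ[ℂ] Matrix (Fin D) (Fin D) ℂ

/-- `id ⊗ Φ` acting on operators on `ℂ^ι ⊗ ℂ^m`. -/
def idTensor {ι m n : Type*} (Φ : Matrix m m ℂ →ₗ[ℂ] Matrix n n ℂ)
    (X : Matrix (ι × m) (ι × m) ℂ) : Matrix (ι × n) (ι × n) ℂ :=
  Matrix.of fun x y => Φ (Matrix.of fun c c' => X (x.1, c) (y.1, c')) x.2 y.2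

/-- A density matrix: positive semidefinite of unit trace. -/
def IsDensity {n : Type*} [Fintype n] (ρ : Matrix n n ℂ) : Prop :=
  ρ.PosSemidef ∧ ρ.trace = 1

/-- `ρ / Tr ρ`. -/
def normalized {n : Type*} [Fintype n] (ρ : Matrix n n ℂ) : Matrix n n ℂ :=
  ρ.trace⁻¹ • ρ

/-- The maximally entangled state `D⁻¹ ∑_{i,j} |ii⟩⟨jj|`. -/
def maxEntangled (D : ℕ) : Matrix (Fin D × Fin D) (Fin D × Fin D) ℂ :=
  Matrix.of fun x y => if x.1 = x.2 ∧ y.1 = y.2 then (D : ℂ)⁻¹ else 0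

/-! ### Entropies (base 2) -/

/-- Von Neumann entropy `S(ρ) = -Tr ρ log₂ ρ`. -/
def vnEntropy {n : Type*} [Fintype n] [DecidableEq n] (ρ : Matrix n n ℂ) : ℝ :=
  -(cfc (fun x : ℝ => x * Real.logb 2 x) ρ).trace.re

/-- Partial trace over the first factor. -/
def traceFst {m n : Type*} [Fintype m] (ρ : Matrix (m × n) (m × n) ℂ) : Matrix n n ℂ :=
  Matrix.of fun x y => ∑ i, ρ (i, x) (i, y)

/-- Partial trace over the second factor. -/
def traceSnd {m n : Type*} [Fintype n] (ρ : Matrix (m × n) (m × n) ℂ) : Matrix m m ℂ :=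
  Matrix.of fun x y => ∑ j, ρ (x, j) (y, j)

/-- Mutual information `I(A:C) = S(A) + S(C) - S(AC)`. -/
def mutualInfo {A C : Type*} [Fintype A] [DecidableEq A] [Fintype C] [DecidableEq C]
    (ρ : Matrix (A × C) (A × C) ℂ) : ℝ :=
  vnEntropy (traceSnd ρ) + vnEntropy (traceFst ρ) - vnEntropy ρ

/-- Conditional mutual information `I(A:C|B) = S(AB) + S(BC) - S(B) - S(ABC)` of a state on
`A ⊗ B ⊗ C`, indexed as `(A × B) × C`. -/
def condMutualInfo {A B C : Type*} [Fintype A] [DecidableEq A] [Fintype B] [DecidableEq B]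
    [Fintype C] [DecidableEq C] (ρ : Matrix ((A × B) × C) ((A × B) × C) ℂ) : ℝ :=
  vnEntropy (traceSnd ρ)
    + vnEntropy (Matrix.of fun (x y : B × C) => ∑ a, ρ ((a, x.1), x.2) ((a, y.1), y.2))
    - vnEntropy (traceFst (traceSnd ρ)) - vnEntropy ρ

/-! ### The MPDO and its measurement -/

variable {D d : ℕ}

/-- The operator on `A ⊗ B₁⋯B_ℓ ⊗ C` obtained from the maximally entangled state on `A ⊗ C` by
applying the Y-shaped map `N` to the last factor `ℓ` times; each application emits a new site
`B_k`, which is appended on the right of the sites present so far. -/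
def mpdo (N : YMap D d) : (ℓ : ℕ) →
    Matrix ((Fin D × (Fin ℓ → Fin d)) × Fin D) ((Fin D × (Fin ℓ → Fin d)) × Fin D) ℂ
  | 0 => (maxEntangled D).submatrix (fun x => (x.1.1, x.2)) (fun x => (x.1.1, x.2))
  | ℓ + 1 =>
    let f : (Fin D × (Fin (ℓ + 1) → Fin d)) × Fin D →
        (Fin D × (Fin ℓ → Fin d)) × (Fin d × Fin D) :=
      fun x => ((x.1.1, Fin.init x.1.2), (x.1.2 (Fin.last ℓ), x.2))
    (idTensor N.lin (mpdo N ℓ)).submatrix f f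

/-- Projective measurement of `B` in its computational basis: `ρ ↦ ∑_b |b⟩⟨b| ρ |b⟩⟨b|`. -/
def measureB {A B C : Type*} [DecidableEq B] (ρ : Matrix ((A × B) × C) ((A × B) × C) ℂ) :
    Matrix ((A × B) × C) ((A × B) × C) ℂ :=
  Matrix.of fun x y => if x.1.2 = y.1.2 then ρ x y else 0

/-- The (normalized) `B`-measured MPDO with `ℓ` sites in `B`. -/
def measuredMPDO (N : YMap D d) (ℓ : ℕ) :
    Matrix ((Fin D × (Fin ℓ → Fin d)) × Fin D) ((Fin D × (Fin ℓ → Fin d)) × Fin D) ℂ :=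
  normalized (measureB (mpdo N ℓ))

/-- The self-map `M_s[ρ] = ⟨s| N[ρ] |s⟩` belonging to the outcome `s` on one site. -/
def outcomeMap (N : YMap D d) (s : Fin d) : SelfMap D where
  toFun X := (N.lin X).submatrix (Prod.mk s) (Prod.mk s)
  map_add' X Y := by rw [map_add]; rfl
  map_smul' c X := by rw [map_smul]; rfl

/-- `M_b = M_{s_ℓ} ∘ ⋯ ∘ M_{s_1}` for `b = (s_1, …, s_ℓ)`. -/
def wordMap (N : YMap D d) : (ℓ : ℕ) → (Fin ℓ → Fin d) → SelfMap D
  | 0, _ => LinearMap.id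
  | ℓ + 1, b => outcomeMap N (b (Fin.last ℓ)) ∘ₗ wordMap N ℓ (Fin.init b)

/-- `M_b[σ]`, with `M_b` acting on one half of the maximally entangled state `σ`. -/
def outcomeOp (N : YMap D d) {ℓ : ℕ} (b : Fin ℓ → Fin d) :
    Matrix (Fin D × Fin D) (Fin D × Fin D) ℂ :=
  idTensor (wordMap N ℓ b) (maxEntangled D)

/-- The weight `p(b) = Tr M_b[σ]` of the outcome `b`. -/
def outcomeWeight (N : YMap D d) {ℓ : ℕ} (b : Fin ℓ → Fin d) : ℂ :=
  (outcomeOp N b).trace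

/-- The state `ρ_{AC,b} = M_b[σ] / Tr M_b[σ]` after the outcome `b`. -/
def outcomeState (N : YMap D d) {ℓ : ℕ} (b : Fin ℓ → Fin d) :
    Matrix (Fin D × Fin D) (Fin D × Fin D) ℂ :=
  normalized (outcomeOp N b)

/-! ### The conditions -/

/-- `E` is a family of Kraus operators of `M`. -/
def IsKraus {ι : Type*} [Fintype ι] (M : SelfMap D) (E : ι → Matrix (Fin D) (Fin D) ℂ) : Prop :=
  ∀ X, M X = ∑ i, E i * X * (E i)ᴴ

/-- Condition 1: for some number `p + 1 ≥ 1`, each `M_s` has `p + 1` Kraus operators, the last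
of which is invertible, such that the products of its inverse with the other ones generate the
algebra `M_D(ℂ)`. -/
def KrausCondition (N : YMap D d) : Prop :=
  ∃ p : ℕ, ∀ s : Fin d, ∃ E : Fin (p + 1) → Matrix (Fin D) (Fin D) ℂ,
    IsKraus (outcomeMap N s) E ∧ IsUnit (E (Fin.last p)) ∧
    Algebra.adjoin ℂ (Set.range fun i : Fin p => (E (Fin.last p))⁻¹ * E i.castSucc) = ⊤

/-- A strictly positive map sends every state to a positive definite operator. -/
def IsStrictlyPositiveMap (M : SelfMap D) : Prop :=
  ∀ ρ, IsDensity ρ → (M ρ).PosDef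

/-- Condition 2: all sufficiently long products of the maps `M_s` are strictly positive. -/
def PositivityCondition (N : YMap D d) : Prop :=
  ∃ ξ : ℕ, ∀ ℓ, ξ ≤ ℓ → ∀ t : Fin ℓ → Fin d, IsStrictlyPositiveMap (wordMap N ℓ t)

/-- `I(A:C)_b ≤ c₀ e^{-c₁ ℓ}` for all `ℓ` and every outcome `b` of length `ℓ` that can occur. -/
def OutcomeMIDecay (N : YMap D d) (c₀ c₁ : ℝ) : Prop :=
  ∀ (ℓ : ℕ) (b : Fin ℓ → Fin d), outcomeWeight N b ≠ 0 →
    mutualInfo (outcomeState N b) ≤ c₀ * Real.exp (-c₁ * ℓ)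

/-- `I(A:C|B̄) ≤ c₀ e^{-c₁ ℓ}` in the measured MPDO, for all `ℓ` for which the MPDO is nonzero
(so that it can be normalized). -/
def MeasuredCMIDecay (N : YMap D d) (c₀ c₁ : ℝ) : Prop :=
  ∀ ℓ : ℕ, mpdo N ℓ ≠ 0 →
    condMutualInfo (measuredMPDO N ℓ) ≤ c₀ * Real.exp (-c₁ * ℓ)

end

set_option linter.unusedSectionVars false

noncomputable section

/-! ### Elementary properties of the von Neumann entropy -/

/-! Condition 1 gives condition 2 by following kernels. For `X ≥ 0` and Kraus operators `E_i`, the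
kernel of `M[X]` is the set of `v` with every `E_i† v` in `W = ker X`. The invertible Kraus operator
`F` embeds this set into `W` through `F†`. If the embedding were onto, `W` would be invariant under
all `(F⁻¹ E_i)†`, hence under all of `M_D(ℂ)`, so it would be `0` or everything. A nonzero proper
kernel therefore loses a dimension with every letter (`finrank_krausPullback_le`).

Condition 2 gives condition 3 by Hopf's oscillation argument. Compactness of the unit sphere
squeezes each strictly positive word map `M` between `κ Tr X` and `κ⁻¹ Tr X`, with one `κ` for the
finitely many words of length in `[ξ, 2ξ)`. If `a Y ≤ X ≤ b Y`, then `M[X]` and `M[Y]` satisfy such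
bounds with `b - a` reduced by the factor `1 - κ²` (`IsTraceSqueezed.contract`). Taking the last `ξ`
letters off a long word `W` again and again gives `a W[1] ≤ W[X] ≤ b W[1]` with `b - a`
exponentially small: `W` is nearly the rank-one map `X ↦ (Tr W[X] / Tr W[1]) W[1]`, and `ρ_{AC,b}`
is nearly the product of its marginals. The marginals stay above a fixed `δ`, so the mutual
information, a relative entropy, is at most a constant times the squared Hilbert–Schmidt distance to
that product (`mutualInfo_le`).

Condition 3 gives condition 4 because the measured state is block diagonal in `b`: its conditional
mutual information is the average of `I(A:C)_b`, the Shannon entropies of the outcomes cancelling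
(`condMutualInfo_classicalQuantum`). -/

/-- The entropy function `x ↦ -x log₂ x`. -/
def entropyFun (x : ℝ) : ℝ := Real.negMulLog x / Real.log 2

section Entropy

variable {m n o : Type*} [Fintype m] [DecidableEq m] [Fintype n] [DecidableEq n]
  [Fintype o] [DecidableEq o]

theorem vnEntropy_eq_sum_eigenvalues {ρ : Matrix n n ℂ} (h : ρ.IsHermitian) :
    vnEntropy ρ = ∑ i, entropyFun (h.eigenvalues i) := by
  rw [vnEntropy, h.cfc_eq, Matrix.IsHermitian.cfc, Unitary.conjStarAlgAut_apply,
    Matrix.trace_mul_cycle]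
  simp [Matrix.trace, entropyFun, Real.negMulLog, Real.logb, mul_div_assoc, Finset.sum_neg_distrib,
    neg_div]
  have h2 : Complex.log 2 = ((Real.log 2 : ℝ) : ℂ) := by simp
  simp only [h2, ← Complex.ofReal_div, Complex.ofReal_re]

/-- In this form the entropy visibly depends on the characteristic polynomial alone, so reindexing,
unitary conjugation and block sums reduce to identities of polynomials. -/
theorem vnEntropy_eq_sum_roots {ρ : Matrix n n ℂ} (h : ρ.IsHermitian) :
    vnEntropy ρ = (ρ.charpoly.roots.map fun z => entropyFun z.re).sum := by
  rw [vnEntropy_eq_sum_eigenvalues h, h.roots_charpoly_eq_eigenvalues]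
  simp

theorem vnEntropy_congr {ρ : Matrix m m ℂ} {τ : Matrix n n ℂ} (hρ : ρ.IsHermitian)
    (hτ : τ.IsHermitian) (h : ρ.charpoly = τ.charpoly) : vnEntropy ρ = vnEntropy τ := by
  rw [vnEntropy_eq_sum_roots hρ, vnEntropy_eq_sum_roots hτ, h]

theorem vnEntropy_submatrix_equiv {ρ : Matrix n n ℂ} (h : ρ.IsHermitian) (e : m ≃ n) :
    vnEntropy (ρ.submatrix e e) = vnEntropy ρ :=
  vnEntropy_congr (h.submatrix e) h (by simpa using Matrix.charpoly_reindex e.symm ρ)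

theorem vnEntropy_unitary_conj {ρ : Matrix n n ℂ} (h : ρ.IsHermitian) {U : Matrix n n ℂ}
    (hU : U * Uᴴ = 1) : vnEntropy (Uᴴ * ρ * U) = vnEntropy ρ := by
  refine vnEntropy_congr (Matrix.isHermitian_conjTranspose_mul_mul U h) h ?_
  rw [Matrix.charpoly_mul_comm, ← mul_assoc, hU, one_mul]

theorem vnEntropy_diagonal (t : n → ℝ) :
    vnEntropy (Matrix.diagonal fun i => (t i : ℂ)) = ∑ i, entropyFun (t i) := by
  rw [vnEntropy_eq_sum_roots (by simp [Matrix.IsHermitian, Matrix.diagonal_conjTranspose,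
    Pi.star_def]), Matrix.charpoly_diagonal, Polynomial.roots_prod]
  · simp
  · exact Finset.prod_ne_zero_iff.mpr fun i _ => Polynomial.X_sub_C_ne_zero _

theorem charpoly_blockDiagonal (G : o → Matrix n n ℂ) :
    (Matrix.blockDiagonal G).charpoly = ∏ b, (G b).charpoly := by
  simp only [Matrix.charpoly]
  rw [← Matrix.det_blockDiagonal]
  congr 1
  ext ⟨i, b⟩ ⟨j, c⟩
  simp only [Matrix.charmatrix, Matrix.blockDiagonal_apply, Matrix.sub_apply,
    Matrix.scalar_apply, Matrix.diagonal_apply, RingHom.mapMatrix_apply, Matrix.map_apply,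
    Prod.mk.injEq]
  by_cases hb : b = c <;> simp [hb]

theorem vnEntropy_blockDiagonal {G : o → Matrix n n ℂ} (h : ∀ b, (G b).IsHermitian) :
    vnEntropy (Matrix.blockDiagonal G) = ∑ b, vnEntropy (G b) := by
  have hG : (Matrix.blockDiagonal G).IsHermitian := by
    rw [Matrix.IsHermitian, Matrix.blockDiagonal_conjTranspose]
    exact congrArg _ (funext h)
  rw [vnEntropy_eq_sum_roots hG, charpoly_blockDiagonal, Polynomial.roots_prod]
  · simp [Multiset.map_bind, Multiset.sum_bind, vnEntropy_eq_sum_roots (h _)]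
  · exact Finset.prod_ne_zero_iff.mpr fun b _ => (Matrix.charpoly_monic _).ne_zero

theorem vnEntropy_zero : vnEntropy (0 : Matrix n n ℂ) = 0 := by
  simpa [entropyFun] using vnEntropy_diagonal (0 : n → ℝ)

theorem sum_eigenvalues_eq_re_trace {ρ : Matrix n n ℂ} (h : ρ.IsHermitian) :
    ∑ i, h.eigenvalues i = ρ.trace.re := by
  simp [h.trace_eq_sum_eigenvalues]

theorem entropyFun_mul (q x : ℝ) :
    entropyFun (q * x) = x * entropyFun q + q * entropyFun x := by
  rw [entropyFun, Real.negMulLog_mul, entropyFun, entropyFun]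
  ring

/-- Diagonalization of a Hermitian matrix by a unitary matrix. -/
theorem exists_unitary_diagonalization {ρ : Matrix n n ℂ} (h : ρ.IsHermitian) :
    ∃ U : Matrix n n ℂ, U * Uᴴ = 1 ∧ Uᴴ * U = 1 ∧
      Uᴴ * ρ * U = Matrix.diagonal fun i => (h.eigenvalues i : ℂ) := by
  have hUU := (Matrix.mem_unitaryGroup_iff).1 h.eigenvectorUnitary.2
  have hUU' := (Matrix.mem_unitaryGroup_iff').1 h.eigenvectorUnitary.2
  refine ⟨(h.eigenvectorUnitary).1, hUU, hUU', ?_⟩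
  have := h.spectral_theorem
  rw [Unitary.conjStarAlgAut_apply] at this
  set U := (h.eigenvectorUnitary).1
  change ρ = U * Matrix.diagonal (fun i => (h.eigenvalues i : ℂ)) * Uᴴ at this
  change U * Uᴴ = 1 at hUU
  change Uᴴ * U = 1 at hUU'
  generalize Matrix.diagonal (fun i => (h.eigenvalues i : ℂ)) = T at this ⊢
  rw [this, show Uᴴ * (U * T * Uᴴ) * U = (Uᴴ * U) * T * (Uᴴ * U) by
        simp only [mul_assoc], hUU', one_mul, mul_one]

/-- Scaling a matrix of unit trace. -/
theorem vnEntropy_smul {ρ : Matrix n n ℂ} (h : ρ.IsHermitian) (htr : ρ.trace = 1) (q : ℝ) :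
    vnEntropy ((q : ℂ) • ρ) = entropyFun q + q * vnEntropy ρ := by
  obtain ⟨U, hUU, -, hd⟩ := exists_unitary_diagonalization h
  have hq : ((q : ℂ) • ρ).IsHermitian := by
    simp [Matrix.IsHermitian, Matrix.conjTranspose_smul, h.eq]
  rw [← vnEntropy_unitary_conj hq hUU, Matrix.mul_smul, Matrix.smul_mul, hd,
    vnEntropy_eq_sum_eigenvalues h, ← Matrix.diagonal_smul]
  have := vnEntropy_diagonal fun i => q * h.eigenvalues i
  simp only [Complex.ofReal_mul] at this
  refine this.trans ?_
  simp only [entropyFun_mul, Finset.sum_add_distrib, ← Finset.sum_mul, ← Finset.mul_sum]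
  rw [sum_eigenvalues_eq_re_trace, htr]
  simp

end Entropy

/-! ### An upper bound on the mutual information -/

section MutualInfo

variable {m n : Type*} [Fintype m] [DecidableEq m] [Fintype n] [DecidableEq n]

/-- This is `log x ≤ x - 1` at `x = r / t`, the scalar reason why a relative entropy is at most a
quadratic divergence. -/
theorem mul_log_sub_mul_log_le {r t : ℝ} (hr : 0 ≤ r) (ht : 0 < t) :
    r * Real.log r - r * Real.log t ≤ r ^ 2 / t - r := by
  rcases hr.eq_or_lt with rfl | hr
  · simp
  · have h := Real.log_le_sub_one_of_pos (div_pos hr ht)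
    rw [Real.log_div hr.ne' ht.ne'] at h
    calc r * Real.log r - r * Real.log t = r * (Real.log r - Real.log t) := by ring
      _ ≤ r * (r / t - 1) := by gcongr
      _ = r ^ 2 / t - r := by ring

/-- The relative entropy of a positive semidefinite matrix with respect to a positive diagonal one
is bounded by the corresponding quadratic divergence. -/
theorem neg_vnEntropy_sub_sum_log_le {Q : Matrix n n ℂ} (hQ : Q.PosSemidef) {t : n → ℝ}
    (ht : ∀ g, 0 < t g) :
    -vnEntropy Q * Real.log 2 - ∑ g, (Q g g).re * Real.log (t g) ≤
      ∑ g, ((∑ h, ‖Q h g‖ ^ 2) / t g - (Q g g).re) := by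
  obtain ⟨U, hU, hU', hd⟩ := exists_unitary_diagonalization hQ.isHermitian
  set r := hQ.isHermitian.eigenvalues
  have hr : ∀ i, 0 ≤ r i := hQ.eigenvalues_nonneg
  have hQU : Q = U * Matrix.diagonal (fun i => (r i : ℂ)) * Uᴴ := by
    rw [← hd, show U * (Uᴴ * Q * U) * Uᴴ = (U * Uᴴ) * Q * (U * Uᴴ) by simp only [mul_assoc], hU,
      one_mul, mul_one]
  have hcol : ∀ i, ∑ g, ‖U g i‖ ^ 2 = 1 := by
    intro i
    have := congrFun (congrFun hU' i) i
    simp only [Matrix.mul_apply, Matrix.conjTranspose_apply, Matrix.one_apply_eq,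
      RCLike.star_def, Complex.conj_mul'] at this
    exact_mod_cast this
  have hdiag : ∀ g, (Q g g).re = ∑ i, ‖U g i‖ ^ 2 * r i := by
    intro g
    have : Q g g = ((∑ i, ‖U g i‖ ^ 2 * r i : ℝ) : ℂ) := by
      conv_lhs => rw [hQU]
      rw [Matrix.mul_apply]
      simp only [Matrix.mul_diagonal, Matrix.conjTranspose_apply, RCLike.star_def]
      push_cast
      refine Finset.sum_congr rfl fun i _ => ?_
      rw [← Complex.mul_conj']
      ring
    rw [this, Complex.ofReal_re]
  have hsq : ∀ g, ∑ h, ‖Q h g‖ ^ 2 = ∑ i, ‖U g i‖ ^ 2 * r i ^ 2 := by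
    intro g
    have h1 : ((∑ h, ‖Q h g‖ ^ 2 : ℝ) : ℂ) = (Qᴴ * Q) g g := by
      rw [Matrix.mul_apply]
      simp [Matrix.conjTranspose_apply, RCLike.star_def, Complex.conj_mul']
    have h2 : Qᴴ * Q = U * Matrix.diagonal (fun i => ((r i ^ 2 : ℝ) : ℂ)) * Uᴴ := by
      rw [hQ.isHermitian.eq]
      conv_lhs => rw [hQU]
      generalize hT : Matrix.diagonal (fun i => (r i : ℂ)) = T
      rw [show U * T * Uᴴ * (U * T * Uᴴ) = U * (T * (Uᴴ * U) * T) * Uᴴ by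
        simp only [mul_assoc], hU', mul_one, ← hT, Matrix.diagonal_mul_diagonal]
      simp [pow_two]
    have : (Qᴴ * Q) g g = ((∑ i, ‖U g i‖ ^ 2 * r i ^ 2 : ℝ) : ℂ) := by
      rw [h2, Matrix.mul_apply]
      simp only [Matrix.mul_diagonal, Matrix.conjTranspose_apply, RCLike.star_def]
      push_cast
      refine Finset.sum_congr rfl fun i _ => ?_
      rw [← Complex.mul_conj']
      ring
    exact_mod_cast h1.trans this
  -- The weights `‖U g i‖ ^ 2` sum to one over `g`, so every term becomes a weighted sum over pairs
  -- `(r i, t g)` and the scalar inequality applies pair by pair.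
  have hS : -vnEntropy Q * Real.log 2 = ∑ g, ∑ i, ‖U g i‖ ^ 2 * (r i * Real.log (r i)) := by
    rw [Finset.sum_comm]
    simp only [← Finset.sum_mul, hcol, one_mul]
    rw [vnEntropy_eq_sum_eigenvalues hQ.isHermitian, ← Finset.sum_neg_distrib, Finset.sum_mul]
    refine Finset.sum_congr rfl fun i _ => ?_
    have : Real.log 2 ≠ 0 := (Real.log_pos one_lt_two).ne'
    rw [entropyFun, Real.negMulLog]
    field_simp
    rfl
  rw [hS, ← Finset.sum_sub_distrib]
  refine Finset.sum_le_sum fun g _ => ?_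
  rw [hsq, hdiag, Finset.sum_mul, Finset.sum_div, ← Finset.sum_sub_distrib,
    ← Finset.sum_sub_distrib]
  refine Finset.sum_le_sum fun i _ => ?_
  have := mul_le_mul_of_nonneg_left (mul_log_sub_mul_log_le (hr i) (ht g)) (sq_nonneg ‖U g i‖)
  calc _ = ‖U g i‖ ^ 2 * (r i * Real.log (r i) - r i * Real.log (t g)) := by ring
    _ ≤ _ := this
    _ = _ := by ring

open scoped Kronecker

/-- The adjoint of the partial trace is `B ↦ B ⊗ 1`. Testing against every `B` then yields the
conjugation rules without computing entries. -/
theorem trace_traceSnd_mul (ρ : Matrix (m × n) (m × n) ℂ) (B : Matrix m m ℂ) :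
    (traceSnd ρ * B).trace = (ρ * (B ⊗ₖ (1 : Matrix n n ℂ))).trace := by
  simp only [Matrix.trace, Matrix.diag_apply, Matrix.mul_apply, traceSnd, Matrix.of_apply,
    Fintype.sum_prod_type, Matrix.kroneckerMap_apply, Matrix.one_apply, mul_ite, mul_one, mul_zero,
    Finset.sum_ite_eq', Finset.sum_mul, Finset.mem_univ, if_true]
  exact Finset.sum_congr rfl fun i _ => Finset.sum_comm

theorem trace_traceFst_mul (ρ : Matrix (m × n) (m × n) ℂ) (B : Matrix n n ℂ) :
    (traceFst ρ * B).trace = (ρ * ((1 : Matrix m m ℂ) ⊗ₖ B)).trace := by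
  simp only [Matrix.trace, Matrix.diag_apply, Matrix.mul_apply, traceFst, Matrix.of_apply,
    Fintype.sum_prod_type_right, Matrix.kroneckerMap_apply, Matrix.one_apply, ite_mul, one_mul,
    zero_mul, mul_ite, mul_zero, Finset.sum_ite_eq', Finset.sum_mul, Finset.mem_univ, if_true]
  exact Finset.sum_congr rfl fun i _ => Finset.sum_comm

theorem traceSnd_kronecker_conj (ρ : Matrix (m × n) (m × n) ℂ) (U : Matrix m m ℂ)
    {V : Matrix n n ℂ} (hV : V * Vᴴ = 1) :
    traceSnd ((U ⊗ₖ V)ᴴ * ρ * (U ⊗ₖ V)) = Uᴴ * traceSnd ρ * U := by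
  refine Matrix.ext_iff_trace_mul_right.2 fun B => ?_
  rw [trace_traceSnd_mul, mul_assoc, mul_assoc, Matrix.trace_mul_comm, mul_assoc,
    Matrix.conjTranspose_kronecker, ← Matrix.mul_kronecker_mul, ← Matrix.mul_kronecker_mul,
    mul_one, hV, ← trace_traceSnd_mul]
  simp only [mul_assoc]
  rw [Matrix.trace_mul_comm Uᴴ]
  simp only [mul_assoc]

theorem traceFst_kronecker_conj (ρ : Matrix (m × n) (m × n) ℂ) {U : Matrix m m ℂ}
    (V : Matrix n n ℂ) (hU : U * Uᴴ = 1) :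
    traceFst ((U ⊗ₖ V)ᴴ * ρ * (U ⊗ₖ V)) = Vᴴ * traceFst ρ * V := by
  refine Matrix.ext_iff_trace_mul_right.2 fun B => ?_
  rw [trace_traceFst_mul, mul_assoc, mul_assoc, Matrix.trace_mul_comm, mul_assoc,
    Matrix.conjTranspose_kronecker, ← Matrix.mul_kronecker_mul, ← Matrix.mul_kronecker_mul,
    mul_one, hU, ← trace_traceFst_mul]
  simp only [mul_assoc]
  rw [Matrix.trace_mul_comm Vᴴ]
  simp only [mul_assoc]

theorem trace_traceSnd (ρ : Matrix (m × n) (m × n) ℂ) : (traceSnd ρ).trace = ρ.trace := by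
  simpa using trace_traceSnd_mul ρ 1

theorem trace_traceFst (ρ : Matrix (m × n) (m × n) ℂ) : (traceFst ρ).trace = ρ.trace := by
  simpa using trace_traceFst_mul ρ 1

theorem Matrix.PosSemidef.traceSnd {ρ : Matrix (m × n) (m × n) ℂ} (h : ρ.PosSemidef) :
    (traceSnd ρ).PosSemidef := by
  have : _root_.traceSnd ρ =
      ∑ j, ρ.submatrix (fun i => (i, j)) (fun i => (i, j)) := by
    ext
    simp [_root_.traceSnd, Matrix.sum_apply]
  rw [this]
  exact Matrix.posSemidef_sum _ fun j _ => h.submatrix _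

theorem Matrix.PosSemidef.traceFst {ρ : Matrix (m × n) (m × n) ℂ} (h : ρ.PosSemidef) :
    (traceFst ρ).PosSemidef := by
  have : _root_.traceFst ρ =
      ∑ i, ρ.submatrix (fun j => (i, j)) (fun j => (i, j)) := by
    ext
    simp [_root_.traceFst, Matrix.sum_apply]
  rw [this]
  exact Matrix.posSemidef_sum _ fun j _ => h.submatrix _

theorem sum_norm_sq_eq_re_trace (M : Matrix n n ℂ) :
    ∑ g, ∑ h, ‖M h g‖ ^ 2 = (Mᴴ * M).trace.re := by
  have : (Mᴴ * M).trace = ((∑ g, ∑ h, ‖M h g‖ ^ 2 : ℝ) : ℂ) := by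
    simp [Matrix.trace, Matrix.mul_apply, Complex.conj_mul']
  rw [this, Complex.ofReal_re]

theorem sum_norm_sq_unitary_conj (M : Matrix n n ℂ) {W : Matrix n n ℂ} (hW : W * Wᴴ = 1) :
    ∑ g, ∑ h, ‖(Wᴴ * M * W) h g‖ ^ 2 = ∑ g, ∑ h, ‖M h g‖ ^ 2 := by
  rw [sum_norm_sq_eq_re_trace, sum_norm_sq_eq_re_trace]
  simp only [Matrix.conjTranspose_mul, Matrix.conjTranspose_conjTranspose]
  rw [show Wᴴ * (Mᴴ * W) * (Wᴴ * M * W) = Wᴴ * (Mᴴ * (W * Wᴴ) * M * W) by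
    simp only [mul_assoc], hW, mul_one, Matrix.trace_mul_comm, mul_assoc, hW, mul_one]

theorem mutualInfo_unitary_conj {ρ : Matrix (m × n) (m × n) ℂ} (hρ : ρ.PosSemidef)
    {U : Matrix m m ℂ} {V : Matrix n n ℂ} (hU : U * Uᴴ = 1) (hV : V * Vᴴ = 1) :
    mutualInfo ((U ⊗ₖ V)ᴴ * ρ * (U ⊗ₖ V)) = mutualInfo ρ := by
  rw [mutualInfo, mutualInfo, traceSnd_kronecker_conj ρ U hV, traceFst_kronecker_conj ρ V hU,
    vnEntropy_unitary_conj hρ.traceSnd.isHermitian hU,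
    vnEntropy_unitary_conj hρ.traceFst.isHermitian hV,
    vnEntropy_unitary_conj hρ.isHermitian]
  rw [Matrix.conjTranspose_kronecker, ← Matrix.mul_kronecker_mul, hU, hV, Matrix.one_kronecker_one]

/-- The bound on the mutual information when both marginals are diagonal. -/
theorem mutualInfo_le_of_diagonal_marginals {Q : Matrix (m × n) (m × n) ℂ} (hQ : Q.PosSemidef)
    (htr : Q.trace = 1) {a : m → ℝ} {c : n → ℝ} {δ : ℝ} (hδ : 0 < δ)
    (ha : traceSnd Q = Matrix.diagonal fun i => (a i : ℂ))
    (hc : traceFst Q = Matrix.diagonal fun i => (c i : ℂ))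
    (hal : ∀ i, δ ≤ a i) (hcl : ∀ i, δ ≤ c i) :
    mutualInfo Q ≤
      (∑ g, ∑ h, ‖(Q - traceSnd Q ⊗ₖ traceFst Q) h g‖ ^ 2) / (δ ^ 2 * Real.log 2) := by
  have hlog : 0 < Real.log 2 := Real.log_pos one_lt_two
  have ha0 : ∀ i, 0 < a i := fun i => hδ.trans_le (hal i)
  have hc0 : ∀ i, 0 < c i := fun i => hδ.trans_le (hcl i)
  set t : m × n → ℝ := fun g => a g.1 * c g.2 with ht_def
  have ht : ∀ g, 0 < t g := fun g => mul_pos (ha0 _) (hc0 _)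
  have htl : ∀ g, δ ^ 2 ≤ t g := fun g => by
    rw [pow_two]
    exact mul_le_mul (hal _) (hcl _) hδ.le (ha0 _).le
  have hat : ∀ i, ∑ j, (Q (i, j) (i, j)).re = a i := by
    intro i
    have := congrArg Complex.re (congrFun (congrFun ha i) i)
    simpa [traceSnd] using this
  have hct : ∀ j, ∑ i, (Q (i, j) (i, j)).re = c j := by
    intro j
    have := congrArg Complex.re (congrFun (congrFun hc j) j)
    simpa [traceFst] using this
  have hτ : traceSnd Q ⊗ₖ traceFst Q = Matrix.diagonal fun g => (t g : ℂ) := by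
    rw [ha, hc, Matrix.diagonal_kronecker_diagonal]
    simp [t]
  have hsum1 : ∑ g, (Q g g).re = 1 := by
    have := congrArg Complex.re htr
    simpa [Matrix.trace] using this
  have hsumt : ∑ g, t g = 1 := by
    have h1 : ∑ i, a i = 1 := by
      rw [← hsum1, Fintype.sum_prod_type]
      exact Finset.sum_congr rfl fun i _ => (hat i).symm
    have h2 : ∑ i, c i = 1 := by
      rw [← hsum1, Fintype.sum_prod_type_right]
      exact Finset.sum_congr rfl fun i _ => (hct i).symm
    rw [Fintype.sum_prod_type]
    simp only [t, ← Finset.mul_sum, h2, mul_one, h1]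
  have hent : (vnEntropy (traceSnd Q) + vnEntropy (traceFst Q)) * Real.log 2 =
      - ∑ g, (Q g g).re * Real.log (t g) := by
    have h1 : ∀ x : ℝ, entropyFun x * Real.log 2 = - (x * Real.log x) := by
      intro x
      rw [entropyFun, div_mul_cancel₀ _ hlog.ne', Real.negMulLog]
      ring
    rw [ha, hc, vnEntropy_diagonal, vnEntropy_diagonal, add_mul, Finset.sum_mul, Finset.sum_mul]
    simp only [h1, t, Real.log_mul (ha0 _).ne' (hc0 _).ne', mul_add, Finset.sum_add_distrib,
      Finset.sum_neg_distrib, neg_add]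
    congr 2
    · rw [Fintype.sum_prod_type]
      simp only [← Finset.sum_mul, hat]
    · rw [Fintype.sum_prod_type_right]
      simp only [← Finset.sum_mul, hct]
  have hmain := neg_vnEntropy_sub_sum_log_le hQ ht
  rw [le_div_iff₀ (by positivity)]
  -- Completing the square: `Q` and the diagonal matrix of `t` differ only on the diagonal in their
  -- effect here, and the leftover `(Q g g).re - t g` sums to zero since both have trace one.
  have hkey : ∀ g, (∑ h, ‖Q h g‖ ^ 2) / t g - (Q g g).re =
      (∑ h, ‖(Q - traceSnd Q ⊗ₖ traceFst Q) h g‖ ^ 2) / t g + ((Q g g).re - t g) := by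
    intro g
    have h1 : ∑ h, ‖(Q - traceSnd Q ⊗ₖ traceFst Q) h g‖ ^ 2 =
        ∑ h, ‖Q h g‖ ^ 2 - 2 * t g * (Q g g).re + t g ^ 2 := by
      rw [hτ]
      have h2 : ∀ h, ‖(Q - Matrix.diagonal fun g => (t g : ℂ)) h g‖ ^ 2 =
          ‖Q h g‖ ^ 2 + if h = g then - 2 * t g * (Q g g).re + t g ^ 2 else 0 := by
        intro h
        by_cases hg : h = g
        · subst hg
          simp only [Matrix.sub_apply, Matrix.diagonal_apply_eq, if_true, ← Complex.normSq_eq_norm_sq,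
            Complex.normSq_apply, Complex.sub_re, Complex.sub_im, Complex.ofReal_re,
            Complex.ofReal_im]
          ring
        · simp [hg]
      simp only [h2, Finset.sum_add_distrib, Finset.sum_ite_eq', Finset.mem_univ, if_true]
      ring
    rw [h1]
    have := (ht g).ne'
    field_simp
    ring
  simp only [hkey, Finset.sum_add_distrib, Finset.sum_sub_distrib, hsum1, hsumt, sub_self,
    add_zero] at hmain
  have h3 : ∑ g, (∑ h, ‖(Q - traceSnd Q ⊗ₖ traceFst Q) h g‖ ^ 2) / t g ≤
      (∑ g, ∑ h, ‖(Q - traceSnd Q ⊗ₖ traceFst Q) h g‖ ^ 2) / δ ^ 2 := by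
    rw [Finset.sum_div]
    exact Finset.sum_le_sum fun g _ =>
      div_le_div_of_nonneg_left (Finset.sum_nonneg fun _ _ => sq_nonneg _) (by positivity) (htl g)
  have h4 : mutualInfo Q * Real.log 2 ≤
      (∑ g, ∑ h, ‖(Q - traceSnd Q ⊗ₖ traceFst Q) h g‖ ^ 2) / δ ^ 2 := by
    refine le_trans ?_ h3
    refine le_trans (le_of_eq ?_) hmain
    rw [mutualInfo, sub_mul, hent]
    ring
  rw [le_div_iff₀ (by positivity)] at h4
  linarith

/-- The mutual information is bounded by the squared Hilbert--Schmidt distance to the product of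
the marginals, if these are bounded from below. -/
theorem mutualInfo_le {ρ : Matrix (m × n) (m × n) ℂ} (hρ : ρ.PosSemidef)
    (htr : ρ.trace = 1) {δ : ℝ} (hδ : 0 < δ)
    (ha : (traceSnd ρ - (δ : ℂ) • 1).PosSemidef) (hc : (traceFst ρ - (δ : ℂ) • 1).PosSemidef) :
    mutualInfo ρ ≤
      (∑ g, ∑ h, ‖(ρ - traceSnd ρ ⊗ₖ traceFst ρ) h g‖ ^ 2) / (δ ^ 2 * Real.log 2) := by
  -- A local unitary `U ⊗ V` diagonalizes both marginals and changes neither the mutual information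
  -- nor the Hilbert–Schmidt distance.
  obtain ⟨U, hU, hU', hUd⟩ := exists_unitary_diagonalization hρ.traceSnd.isHermitian
  obtain ⟨V, hV, hV', hVd⟩ := exists_unitary_diagonalization hρ.traceFst.isHermitian
  set W := U ⊗ₖ V
  have hW : W * Wᴴ = 1 := by
    rw [Matrix.conjTranspose_kronecker, ← Matrix.mul_kronecker_mul, hU, hV,
      Matrix.one_kronecker_one]
  have hS := traceSnd_kronecker_conj ρ U hV
  have hF := traceFst_kronecker_conj ρ V hU
  have h := mutualInfo_le_of_diagonal_marginals (hρ.conjTranspose_mul_mul_same W)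
    (by rw [Matrix.trace_mul_cycle, hW, one_mul, htr]) hδ (hS.trans hUd) (hF.trans hVd) ?_ ?_
  · rw [mutualInfo_unitary_conj hρ hU hV, hS, hF,
      show (Uᴴ * traceSnd ρ * U) ⊗ₖ (Vᴴ * traceFst ρ * V) =
        Wᴴ * (traceSnd ρ ⊗ₖ traceFst ρ) * W by
          rw [Matrix.conjTranspose_kronecker, ← Matrix.mul_kronecker_mul,
            ← Matrix.mul_kronecker_mul],
      ← Matrix.sub_mul, ← Matrix.mul_sub, sum_norm_sq_unitary_conj _ hW] at h
    exact h
  · intro i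
    have := (ha.conjTranspose_mul_mul_same U).diag_nonneg (i := i)
    rw [Matrix.mul_sub, Matrix.sub_mul, hUd, Matrix.mul_smul, Matrix.smul_mul, mul_one, hU'] at this
    simpa using Complex.le_def.1 this
  · intro i
    have := (hc.conjTranspose_mul_mul_same V).diag_nonneg (i := i)
    rw [Matrix.mul_sub, Matrix.sub_mul, hVd, Matrix.mul_smul, Matrix.smul_mul, mul_one, hV'] at this
    simpa using Complex.le_def.1 this

end MutualInfo

/-! ### Complete positivity -/

section CompletePositivity

open scoped Matrix.Norms.L2Operator MatrixOrder CStarAlgebra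

/-- A positive semidefinite operator on `ℂ^k ⊗ ℂ^n`, seen as a matrix of matrices, is positive. -/
theorem cstarMatrix_nonneg_of_posSemidef {k n : Type*} [Fintype k] [DecidableEq k] [Fintype n]
    [DecidableEq n] {X : Matrix (k × n) (k × n) ℂ} (hX : X.PosSemidef) :
    0 ≤ (CStarMatrix.ofMatrix (Matrix.of fun i j => Matrix.of fun a b => X (i, a) (j, b)) :
      CStarMatrix k k (Matrix n n ℂ)) := by
  obtain ⟨B, rfl⟩ := CStarAlgebra.nonneg_iff_eq_star_mul_self.1 hX.nonneg
  set C : CStarMatrix k k (Matrix n n ℂ) :=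
    CStarMatrix.ofMatrix (Matrix.of fun i j => Matrix.of fun a b => B (i, a) (j, b))
  have : (CStarMatrix.ofMatrix (Matrix.of fun i j => Matrix.of fun a b => (star B * B) (i, a) (j, b)) :
      CStarMatrix k k (Matrix n n ℂ)) = star C * C := by
    ext i j a b
    rw [CStarMatrix.mul_apply]
    simp [CStarMatrix.ofMatrix_apply, Matrix.sum_apply, CStarMatrix.star_apply, C,
      Matrix.mul_apply, Matrix.star_apply, Fintype.sum_prod_type]
  rw [this]
  exact star_mul_self_nonneg C

/-- Nonnegative elements of a star-ordered ring are sums of elements `star C * C`, and flattening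
the two levels of indices turns each of these into a Gram matrix `Bᴴ * B`. -/
theorem posSemidef_of_cstarMatrix_nonneg {k n : Type*} [Fintype k] [DecidableEq k] [Fintype n]
    [DecidableEq n] {M : CStarMatrix k k (Matrix n n ℂ)} (hM : 0 ≤ M) :
    (Matrix.of fun (x y : k × n) => M x.1 y.1 x.2 y.2).PosSemidef := by
  rw [StarOrderedRing.nonneg_iff] at hM
  induction hM using AddSubmonoid.closure_induction with
  | mem M hM =>
    obtain ⟨C, rfl⟩ := hM
    set B : Matrix (k × n) (k × n) ℂ := Matrix.of fun x y => C x.1 y.1 x.2 y.2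
    have : (Matrix.of fun (x y : k × n) => (star C * C) x.1 y.1 x.2 y.2) = Bᴴ * B := by
      ext ⟨i, a⟩ ⟨j, b⟩
      rw [Matrix.of_apply, CStarMatrix.mul_apply]
      simp [Matrix.sum_apply, CStarMatrix.star_apply, B, Matrix.mul_apply, Matrix.star_apply,
        Fintype.sum_prod_type]
    exact this ▸ Matrix.posSemidef_conjTranspose_mul_self B
  | zero => exact Matrix.PosSemidef.zero
  | add M M' _ _ h h' => exact h.add h'

/-- Complete positivity is given for matrices over a C⋆-algebra; the two preceding translations turn
it into positivity of `id ⊗ N`. -/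
theorem posSemidef_idTensor_lin {D d : ℕ} (N : YMap D d) {k : ℕ}
    {X : Matrix (Fin k × Fin D) (Fin k × Fin D) ℂ} (hX : X.PosSemidef) :
    (idTensor N.lin X).PosSemidef :=
  posSemidef_of_cstarMatrix_nonneg
    (N.map_cstarMatrix_nonneg' k _ (cstarMatrix_nonneg_of_posSemidef hX))

end CompletePositivity

/-! ### Positivity of the word maps and the diagonal blocks of the MPDO -/

section Outcome

variable {D d : ℕ} (N : YMap D d)

theorem posSemidef_idTensor_outcomeMap (s : Fin d) {k : ℕ}
    {X : Matrix (Fin k × Fin D) (Fin k × Fin D) ℂ} (hX : X.PosSemidef) :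
    (idTensor (outcomeMap N s) X).PosSemidef :=
  (posSemidef_idTensor_lin N hX).submatrix fun x : Fin k × Fin D => (x.1, (s, x.2))

theorem posSemidef_idTensor_wordMap {ℓ : ℕ} (b : Fin ℓ → Fin d) {k : ℕ}
    {X : Matrix (Fin k × Fin D) (Fin k × Fin D) ℂ} (hX : X.PosSemidef) :
    (idTensor (wordMap N ℓ b) X).PosSemidef := by
  induction ℓ with
  | zero => exact hX
  | succ ℓ ih => exact posSemidef_idTensor_outcomeMap N (b (Fin.last ℓ)) (ih (Fin.init b))

theorem posSemidef_wordMap {ℓ : ℕ} (b : Fin ℓ → Fin d) {X : Matrix (Fin D) (Fin D) ℂ}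
    (hX : X.PosSemidef) : (wordMap N ℓ b X).PosSemidef :=
  (posSemidef_idTensor_wordMap N b (k := 1) (hX.submatrix Prod.snd)).submatrix fun i => (0, i)

theorem posSemidef_maxEntangled (D : ℕ) : (maxEntangled D).PosSemidef := by
  have : maxEntangled D = (D : ℂ)⁻¹ •
      vecMulVec (fun x : Fin D × Fin D => if x.1 = x.2 then (1 : ℂ) else 0)
        (star fun x : Fin D × Fin D => if x.1 = x.2 then (1 : ℂ) else 0) := by
    ext x y
    by_cases hx : x.1 = x.2 <;> by_cases hy : y.1 = y.2 <;>
      simp [maxEntangled, vecMulVec_apply, hx, hy]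
  rw [this]
  exact (Matrix.posSemidef_vecMulVec_self_star _).smul (by simp)

theorem posSemidef_outcomeOp {ℓ : ℕ} (b : Fin ℓ → Fin d) : (outcomeOp N b).PosSemidef :=
  posSemidef_idTensor_wordMap N b (posSemidef_maxEntangled D)

/-- The diagonal blocks of the MPDO are the unnormalized post-measurement operators. -/
theorem mpdo_apply_of_eq {ℓ : ℕ} (b : Fin ℓ → Fin d) (a a' c c' : Fin D) :
    mpdo N ℓ ((a, b), c) ((a', b), c') = outcomeOp N b (a, c) (a', c') := by
  induction ℓ generalizing c c' with
  | zero => rfl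
  | succ ℓ ih =>
    change N.lin (Matrix.of fun c c' => mpdo N ℓ ((a, Fin.init b), c) ((a', Fin.init b), c'))
      (b (Fin.last ℓ), c) (b (Fin.last ℓ), c') = _
    simp only [ih]
    rfl

end Outcome

/-! ### Classical-quantum states -/

section ClassicalQuantum

variable {A B C : Type*} [Fintype A] [DecidableEq A] [Fintype B] [DecidableEq B]
  [Fintype C] [DecidableEq C]

/-- The operator `∑_b G_b ⊗ |b⟩⟨b|`, with `B` placed between `A` and `C`. -/
def classicalQuantum (G : B → Matrix (A × C) (A × C) ℂ) :
    Matrix ((A × B) × C) ((A × B) × C) ℂ :=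
  Matrix.of fun x y => if x.1.2 = y.1.2 then G x.1.2 (x.1.1, x.2) (y.1.1, y.2) else 0

theorem vnEntropy_of_blocks {m n : Type*} [Fintype m] [DecidableEq m] [Fintype n] [DecidableEq n]
    {G : B → Matrix n n ℂ} (hG : ∀ b, (G b).IsHermitian) (e : m ≃ n × B) {ρ : Matrix m m ℂ}
    (h : ∀ x y, ρ x y = if (e x).2 = (e y).2 then G (e x).2 (e x).1 (e y).1 else 0) :
    vnEntropy ρ = ∑ b, vnEntropy (G b) := by
  have : ρ = (Matrix.blockDiagonal G).submatrix e e := by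
    ext x y
    rw [h, Matrix.submatrix_apply, Matrix.blockDiagonal_apply]
  rw [← vnEntropy_blockDiagonal hG, this]
  refine vnEntropy_submatrix_equiv ?_ e
  rw [Matrix.IsHermitian, Matrix.blockDiagonal_conjTranspose]
  exact congrArg _ (funext hG)

/-- An outcome of weight zero has no normalized state, so the unit trace is demanded only when `q ≠
0`. -/
theorem vnEntropy_smul_of_ne_zero {n : Type*} [Fintype n] [DecidableEq n] {τ : Matrix n n ℂ} {q : ℝ}
    (hτ : τ.IsHermitian) (htr : q ≠ 0 → τ.trace = 1) :
    vnEntropy ((q : ℂ) • τ) = entropyFun q + q * vnEntropy τ := by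
  by_cases hq : q = 0
  · simp [hq, vnEntropy_zero, entropyFun]
  · exact vnEntropy_smul hτ (htr hq) q

theorem Matrix.IsHermitian.ofReal_smul {n : Type*} {τ : Matrix n n ℂ} (hτ : τ.IsHermitian) (q : ℝ) :
    ((q : ℂ) • τ).IsHermitian := by
  simp [Matrix.IsHermitian, Matrix.conjTranspose_smul, hτ.eq]

/-- The conditional mutual information of `∑_b q_b ρ_b ⊗ |b⟩⟨b|` is the average mutual
information. -/
theorem condMutualInfo_classicalQuantum {q : B → ℝ} {ρ : B → Matrix (A × C) (A × C) ℂ}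
    (hρ : ∀ b, (ρ b).PosSemidef) (htr : ∀ b, q b ≠ 0 → (ρ b).trace = 1) :
    condMutualInfo (classicalQuantum fun b => (q b : ℂ) • ρ b) =
      ∑ b, q b * mutualInfo (ρ b) := by
  have h1 : vnEntropy (traceSnd (classicalQuantum fun b => (q b : ℂ) • ρ b)) =
      ∑ b, (entropyFun (q b) + q b * vnEntropy (traceSnd (ρ b))) := by
    rw [vnEntropy_of_blocks (fun b => (hρ b).traceSnd.isHermitian.ofReal_smul (q b)) (Equiv.refl (A × B))]
    · exact Finset.sum_congr rfl fun b _ => vnEntropy_smul_of_ne_zero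
        (hρ b).traceSnd.isHermitian fun hb => (trace_traceSnd _).trans (htr b hb)
    · intro x y
      by_cases hb : x.2 = y.2 <;> simp [traceSnd, classicalQuantum, hb, Finset.mul_sum]
  have h2 : vnEntropy (Matrix.of fun (x y : B × C) => ∑ a,
      (classicalQuantum fun b => (q b : ℂ) • ρ b) ((a, x.1), x.2) ((a, y.1), y.2)) =
      ∑ b, (entropyFun (q b) + q b * vnEntropy (traceFst (ρ b))) := by
    rw [vnEntropy_of_blocks (fun b => (hρ b).traceFst.isHermitian.ofReal_smul (q b)) (Equiv.prodComm B C)]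
    · exact Finset.sum_congr rfl fun b _ => vnEntropy_smul_of_ne_zero
        (hρ b).traceFst.isHermitian fun hb => (trace_traceFst _).trans (htr b hb)
    · intro x y
      by_cases hb : x.1 = y.1 <;> simp [traceFst, classicalQuantum, hb, Finset.mul_sum]
  have h3 : vnEntropy (traceFst (traceSnd (classicalQuantum fun b => (q b : ℂ) • ρ b))) =
      ∑ b, entropyFun (q b) := by
    rw [← vnEntropy_diagonal]
    congr 1
    ext b b'
    by_cases hb : b = b'
    · subst hb
      by_cases hq : q b = 0
      · simp [traceFst, traceSnd, classicalQuantum, hq]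
      · have := htr b hq
        rw [Matrix.trace, Fintype.sum_prod_type] at this
        simp only [Matrix.diag_apply] at this
        simp [traceFst, traceSnd, classicalQuantum, ← Finset.mul_sum, this]
    · simp [traceFst, traceSnd, classicalQuantum, hb]
  have h4 : vnEntropy (classicalQuantum fun b => (q b : ℂ) • ρ b) =
      ∑ b, (entropyFun (q b) + q b * vnEntropy (ρ b)) := by
    rw [vnEntropy_of_blocks (fun b => (hρ b).isHermitian.ofReal_smul (q b))
      ((Equiv.prodAssoc A B C).trans (((Equiv.refl A).prodCongr (Equiv.prodComm B C)).trans
        (Equiv.prodAssoc A C B).symm))]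
    · exact Finset.sum_congr rfl fun b _ => vnEntropy_smul_of_ne_zero (hρ b).isHermitian (htr b)
    · intro x y
      by_cases hb : x.1.2 = y.1.2 <;> simp [classicalQuantum, hb]
  -- Each of the four entropies carries the same term `∑ entropyFun (q b)`, with signs `+ + - -`, so
  -- these cancel.
  rw [condMutualInfo, h1, h2, h3, h4]
  simp only [mutualInfo, ← Finset.sum_add_distrib, ← Finset.sum_sub_distrib]
  exact Finset.sum_congr rfl fun b _ => by ring

end ClassicalQuantum

/-! ### The measured MPDO as a classical-quantum state -/

section Measured

variable {D d : ℕ} (N : YMap D d)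

theorem measureB_mpdo (ℓ : ℕ) :
    measureB (mpdo N ℓ) = classicalQuantum fun b : Fin ℓ → Fin d => outcomeOp N b := by
  ext ⟨⟨a, b⟩, c⟩ ⟨⟨a', b'⟩, c'⟩
  by_cases hb : b = b'
  · subst hb
    simp [measureB, classicalQuantum, mpdo_apply_of_eq]
  · simp [measureB, classicalQuantum, hb]

theorem outcomeWeight_eq_ofReal {ℓ : ℕ} (b : Fin ℓ → Fin d) :
    outcomeWeight N b = ((outcomeWeight N b).re : ℂ) :=
  Complex.eq_re_of_ofReal_le (r := 0) 
    (by rw [Complex.ofReal_zero]; exact (posSemidef_outcomeOp N b).trace_nonneg)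

theorem outcomeWeight_re_nonneg {ℓ : ℕ} (b : Fin ℓ → Fin d) : 0 ≤ (outcomeWeight N b).re :=
  (Complex.le_def.1 (posSemidef_outcomeOp N b).trace_nonneg).1

theorem trace_outcomeState {ℓ : ℕ} {b : Fin ℓ → Fin d} (hb : outcomeWeight N b ≠ 0) :
    (outcomeState N b).trace = 1 := by
  rw [outcomeState, normalized, Matrix.trace_smul, smul_eq_mul]
  exact inv_mul_cancel₀ hb

theorem posSemidef_outcomeState {ℓ : ℕ} (b : Fin ℓ → Fin d) : (outcomeState N b).PosSemidef :=
  (posSemidef_outcomeOp N b).smul (inv_nonneg.2 (posSemidef_outcomeOp N b).trace_nonneg)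

theorem outcomeOp_eq_smul_outcomeState {ℓ : ℕ} (b : Fin ℓ → Fin d) :
    outcomeOp N b = outcomeWeight N b • outcomeState N b := by
  by_cases hb : outcomeWeight N b = 0
  · rw [hb, zero_smul]
    exact ((posSemidef_outcomeOp N b).trace_eq_zero_iff).1 hb
  · rw [outcomeState, normalized, smul_smul]
    exact (by rw [show (outcomeOp N b).trace = outcomeWeight N b from rfl, mul_inv_cancel₀ hb,
      one_smul])

theorem trace_measureB_mpdo (ℓ : ℕ) :
    (measureB (mpdo N ℓ)).trace =
      ((∑ b : Fin ℓ → Fin d, (outcomeWeight N b).re : ℝ) : ℂ) := by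
  rw [measureB_mpdo]
  push_cast
  simp only [← outcomeWeight_eq_ofReal]
  simp only [Matrix.trace, Matrix.diag_apply, classicalQuantum, Matrix.of_apply, if_true,
    Fintype.sum_prod_type, outcomeWeight]
  rw [Finset.sum_comm]

/-- The decay of the mutual information after each outcome passes to the conditional mutual
information of the measured MPDO. -/
theorem MeasuredCMIDecay.of_outcomeMIDecay {c₀ c₁ : ℝ} (hc₀ : 0 < c₀)
    (h : OutcomeMIDecay N c₀ c₁) : MeasuredCMIDecay N c₀ c₁ := by
  intro ℓ _
  set T : ℝ := ∑ b : Fin ℓ → Fin d, (outcomeWeight N b).re with hT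
  set q : (Fin ℓ → Fin d) → ℝ := fun b => T⁻¹ * (outcomeWeight N b).re with hq
  have hT0 : 0 ≤ T := Finset.sum_nonneg fun b _ => outcomeWeight_re_nonneg N b
  have hq0 : ∀ b, 0 ≤ q b := fun b => mul_nonneg (inv_nonneg.2 hT0) (outcomeWeight_re_nonneg N b)
  have hqp : ∀ b, q b ≠ 0 → outcomeWeight N b ≠ 0 := by
    intro b hb hw
    exact hb (by simp [hq, hw])
  have hρ : measuredMPDO N ℓ = classicalQuantum fun b => (q b : ℂ) • outcomeState N b := by
    rw [measuredMPDO, normalized, trace_measureB_mpdo, measureB_mpdo]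
    ext x y
    simp only [Matrix.smul_apply, classicalQuantum, Matrix.of_apply]
    split_ifs
    · rw [outcomeOp_eq_smul_outcomeState, outcomeWeight_eq_ofReal]
      simp [hq, hT, mul_assoc]
    · simp
  rw [hρ, condMutualInfo_classicalQuantum (posSemidef_outcomeState N)
    fun b hb => trace_outcomeState N (hqp b hb)]
  -- When `T = 0` the convention `T⁻¹ = 0` makes all `q b` vanish. An inequality is enough, since
  -- the bound to be averaged is nonnegative.
  have hsum : ∑ b, q b ≤ 1 := by
    rw [← Finset.mul_sum, ← hT]
    by_cases h0 : T = 0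
    · simp [h0]
    · rw [inv_mul_cancel₀ h0]
  have hpos : 0 ≤ c₀ * Real.exp (-c₁ * ℓ) := by positivity
  calc ∑ b, q b * mutualInfo (outcomeState N b)
      ≤ ∑ b, q b * (c₀ * Real.exp (-c₁ * ℓ)) := by
        refine Finset.sum_le_sum fun b _ => ?_
        by_cases hb : q b = 0
        · simp [hb]
        · exact mul_le_mul_of_nonneg_left (h ℓ b (hqp b hb)) (hq0 b)
    _ = (∑ b, q b) * (c₀ * Real.exp (-c₁ * ℓ)) := by rw [Finset.sum_mul]
    _ ≤ c₀ * Real.exp (-c₁ * ℓ) := mul_le_of_le_one_left hpos hsum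

end Measured

/-! ### Kraus operators that generate the matrix algebra -/

section Kraus

variable {D d : ℕ}

/-- The largest subspace that is mapped into `W` by all the operators `E_i†`. -/
def krausPullback {ι : Type*} (E : ι → Matrix (Fin D) (Fin D) ℂ)
    (W : Submodule ℂ (Fin D → ℂ)) : Submodule ℂ (Fin D → ℂ) :=
  ⨅ i, W.comap (E i)ᴴ.mulVecLin

theorem mem_krausPullback {ι : Type*} {E : ι → Matrix (Fin D) (Fin D) ℂ}
    {W : Submodule ℂ (Fin D → ℂ)} {v : Fin D → ℂ} :
    v ∈ krausPullback E W ↔ ∀ i, (E i)ᴴ *ᵥ v ∈ W := by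
  simp [krausPullback]

/-- `⟨v|M[X]|v⟩` is the sum of the nonnegative numbers `⟨E_i† v|X|E_i† v⟩`, and a positive
semidefinite form vanishes at a vector exactly when the operator kills it. -/
theorem ker_eq_krausPullback {ι : Type*} [Fintype ι] {M : SelfMap D}
    {E : ι → Matrix (Fin D) (Fin D) ℂ} (hE : IsKraus M E) {X : Matrix (Fin D) (Fin D) ℂ}
    (hX : X.PosSemidef) :
    LinearMap.ker (M X).mulVecLin = krausPullback E (LinearMap.ker X.mulVecLin) := by
  ext v
  have hMX : (M X).PosSemidef := by
    rw [hE]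
    exact Matrix.posSemidef_sum _ fun i _ => hX.mul_mul_conjTranspose_same (E i)
  have hq : star v ⬝ᵥ (M X *ᵥ v) =
      ∑ i, star ((E i)ᴴ *ᵥ v) ⬝ᵥ (X *ᵥ ((E i)ᴴ *ᵥ v)) := by
    rw [hE, Matrix.sum_mulVec, dotProduct_sum]
    refine Finset.sum_congr rfl fun i _ => ?_
    rw [Matrix.star_mulVec, Matrix.conjTranspose_conjTranspose, ← Matrix.dotProduct_mulVec,
      Matrix.mulVec_mulVec, Matrix.mulVec_mulVec, mul_assoc]
  rw [mem_krausPullback]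
  simp only [LinearMap.mem_ker, Matrix.mulVecLin_apply]
  rw [← hMX.dotProduct_mulVec_zero_iff, hq,
    Finset.sum_eq_zero_iff_of_nonneg fun i _ => hX.dotProduct_mulVec_nonneg _]
  simp only [Finset.mem_univ, true_implies, hX.dotProduct_mulVec_zero_iff]

/-- A suitable rank-one matrix sends a given nonzero vector to any prescribed vector. -/
theorem eq_bot_or_eq_top_of_forall_mulVec_mem {W : Submodule ℂ (Fin D → ℂ)}
    (h : ∀ (A : Matrix (Fin D) (Fin D) ℂ), ∀ w ∈ W, A *ᵥ w ∈ W) : W = ⊥ ∨ W = ⊤ := by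
  by_cases hW : W = ⊥
  · exact Or.inl hW
  · right
    obtain ⟨w, hw, hw0⟩ := W.exists_mem_ne_zero_of_ne_bot hW
    obtain ⟨k, hk⟩ := Function.ne_iff.1 hw0
    rw [Submodule.eq_top_iff']
    intro x
    have := h (vecMulVec x (Pi.single k (w k)⁻¹)) w hw
    rw [Matrix.vecMulVec_mulVec] at this
    simpa [inv_mul_cancel₀ hk] using this

/-- With `F` the last Kraus operator, `F†` maps the pullback injectively into `W`. If the image is
`W`, write `w = F† v`; then `(F⁻¹ E_i)† w = E_i† v` lies in `W`, so `W` is invariant under the whole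
algebra and must be `⊥`. The subtraction is truncated, so this case fits the bound as `0 ≤ 0 - 1`.
-/
theorem finrank_krausPullback_le {p : ℕ} {E : Fin (p + 1) → Matrix (Fin D) (Fin D) ℂ}
    (hu : IsUnit (E (Fin.last p)))
    (htop : Algebra.adjoin ℂ (Set.range fun i : Fin p => (E (Fin.last p))⁻¹ * E i.castSucc) = ⊤)
    {W : Submodule ℂ (Fin D → ℂ)} (hW : W ≠ ⊤) :
    Module.finrank ℂ (krausPullback E W) ≤ Module.finrank ℂ W - 1 := by
  set F := E (Fin.last p)
  have hdet : IsUnit F.det := (Matrix.isUnit_iff_isUnit_det _).1 hu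
  have hinj : Function.Injective Fᴴ.mulVecLin := by
    have : IsUnit Fᴴ := by simpa using hu.star
    exact Matrix.mulVec_injective_of_isUnit this
  have hmap : (krausPullback E W).map Fᴴ.mulVecLin ≤ W := by
    rintro _ ⟨v, hv, rfl⟩
    exact mem_krausPullback.1 hv (Fin.last p)
  have hrank : Module.finrank ℂ ((krausPullback E W).map Fᴴ.mulVecLin) =
      Module.finrank ℂ (krausPullback E W) := 
    (Submodule.equivMapOfInjective _ hinj _).symm.finrank_eq
  rcases hmap.eq_or_lt with heq | hlt
  · have hinv : ∀ A : Matrix (Fin D) (Fin D) ℂ, ∀ w ∈ W, Aᴴ *ᵥ w ∈ W := by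
      intro A
      have hA : A ∈ Algebra.adjoin ℂ
          (Set.range fun i : Fin p => F⁻¹ * E i.castSucc) := by
        rw [htop]; trivial
      induction hA using Algebra.adjoin_induction with
      | mem A hA =>
        obtain ⟨i, rfl⟩ := hA
        intro w hw
        rw [← heq] at hw
        obtain ⟨v, hv, rfl⟩ := hw
        rw [Matrix.mulVecLin_apply, Matrix.mulVec_mulVec, Matrix.conjTranspose_mul, mul_assoc,
          ← Matrix.conjTranspose_mul, Matrix.mul_nonsing_inv _ hdet, Matrix.conjTranspose_one,
          mul_one]
        exact mem_krausPullback.1 hv _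
      | algebraMap r =>
        intro w hw
        rw [Algebra.algebraMap_eq_smul_one, Matrix.conjTranspose_smul, Matrix.conjTranspose_one,
          Matrix.smul_mulVec, Matrix.one_mulVec]
        exact W.smul_mem _ hw
      | add A B _ _ hA hB =>
        intro w hw
        rw [Matrix.conjTranspose_add, Matrix.add_mulVec]
        exact W.add_mem (hA w hw) (hB w hw)
      | mul A B _ _ hA hB =>
        intro w hw
        rw [Matrix.conjTranspose_mul, ← Matrix.mulVec_mulVec]
        exact hB _ (hA w hw)
    rcases eq_bot_or_eq_top_of_forall_mulVec_mem
      (fun A w hw => by simpa using hinv Aᴴ w hw) with h | h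
    · rw [← hrank, heq, h]
      simp
    · exact absurd h hW
  · have := Submodule.finrank_lt_finrank_of_lt hlt
    omega

theorem posDef_of_ker_eq_bot {X : Matrix (Fin D) (Fin D) ℂ} (hX : X.PosSemidef)
    (h : LinearMap.ker X.mulVecLin = ⊥) : X.PosDef := by
  refine Matrix.PosDef.of_dotProduct_mulVec_pos hX.isHermitian fun x hx => ?_
  refine lt_of_le_of_ne (hX.dotProduct_mulVec_nonneg x) fun h0 => hx ?_
  have : x ∈ LinearMap.ker X.mulVecLin := (hX.dotProduct_mulVec_zero_iff x).1 h0.symm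
  rwa [h] at this

theorem PositivityCondition.of_krausCondition {N : YMap D d} (hD : 0 < D)
    (h : KrausCondition N) : PositivityCondition N := by
  obtain ⟨p, h⟩ := h
  have key : ∀ (ℓ : ℕ) (t : Fin ℓ → Fin d) (ρ : Matrix (Fin D) (Fin D) ℂ), IsDensity ρ →
      Module.finrank ℂ (LinearMap.ker (wordMap N ℓ t ρ).mulVecLin) ≤ D - 1 - ℓ := by
    intro ℓ t ρ hρ
    induction ℓ with
    | zero =>
      have hlt : Module.finrank ℂ (LinearMap.ker ρ.mulVecLin) < Module.finrank ℂ (Fin D → ℂ) := by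
        refine Submodule.finrank_lt fun htop => ?_
        have h0 : ρ = 0 := by
          refine Matrix.toLin'.injective ?_
          rw [map_zero]
          exact LinearMap.ker_eq_top.1 htop
        have := hρ.2
        simp [h0] at this
      rw [Module.finrank_fin_fun] at hlt
      exact Nat.le_sub_one_of_lt hlt
    | succ ℓ ih =>
      obtain ⟨E, hE, hu, htop⟩ := h (t (Fin.last ℓ))
      have ih := ih (Fin.init t)
      change Module.finrank ℂ (LinearMap.ker (outcomeMap N (t (Fin.last ℓ))
        (wordMap N ℓ (Fin.init t) ρ)).mulVecLin) ≤ _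
      rw [ker_eq_krausPullback hE (posSemidef_wordMap N _ hρ.1)]
      -- The previous kernel is proper: by induction its dimension is at most `D - 1 - ℓ`, which is
      -- less than `D`.
      refine (finrank_krausPullback_le hu htop fun h => ?_).trans (by omega)
      rw [h, finrank_top, Module.finrank_fin_fun] at ih
      omega
  refine ⟨D, fun ℓ hℓ t ρ hρ => posDef_of_ker_eq_bot (posSemidef_wordMap N t hρ.1) ?_⟩
  have := key ℓ t ρ hρ
  exact Submodule.finrank_eq_zero.1 (by omega)

end Kraus

/-! ### Strictly positive maps -/

section StrictlyPositive

open Filter Topology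

variable {D d : ℕ}

theorem posSemidef_eq_sum_vecMulVec {n : Type*} [Fintype n] [DecidableEq n] {X : Matrix n n ℂ}
    (hX : X.PosSemidef) : ∃ B : n → n → ℂ, X = ∑ k, vecMulVec (B k) (star (B k)) := by
  open scoped MatrixOrder Matrix.Norms.L2Operator in
  obtain ⟨B, rfl⟩ := CStarAlgebra.nonneg_iff_eq_star_mul_self.1 hX.nonneg
  refine ⟨fun k => star (B k), ?_⟩
  ext i j
  simp [Matrix.mul_apply, Matrix.sum_apply, vecMulVec_apply, Matrix.star_apply]

theorem trace_vecMulVec_star {n : Type*} [Fintype n] (u : n → ℂ) :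
    (vecMulVec u (star u)).trace = ((∑ i, ‖u i‖ ^ 2 : ℝ) : ℂ) := by
  simp [Matrix.trace, vecMulVec_apply, Complex.mul_conj']

theorem dotProduct_star_self_eq {n : Type*} [Fintype n] (v : n → ℂ) :
    star v ⬝ᵥ v = ((∑ i, ‖v i‖ ^ 2 : ℝ) : ℂ) := by
  simp [dotProduct, Complex.conj_mul']

theorem isCompact_unit_vectors {n : Type*} [Fintype n] :
    IsCompact {u : n → ℂ | ∑ i, ‖u i‖ ^ 2 = 1} := by
  refine Metric.isCompact_of_isClosed_isBounded
    (isClosed_eq (by fun_prop) continuous_const) ?_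
  refine (Metric.isBounded_closedBall (x := (0 : n → ℂ)) (r := 1)).subset fun u hu => ?_
  rw [mem_closedBall_zero_iff, pi_norm_le_iff_of_nonneg zero_le_one]
  intro i
  have h1 : ‖u i‖ ^ 2 ≤ ∑ i, ‖u i‖ ^ 2 :=
    Finset.single_le_sum (f := fun i => ‖u i‖ ^ 2) (fun _ _ => sq_nonneg _) (Finset.mem_univ i)
  rw [show ∑ i, ‖u i‖ ^ 2 = 1 from hu] at h1
  exact (sq_le_one_iff₀ (norm_nonneg _)).1 h1

/-- The form `⟨v| M[|u⟩⟨u|] |v⟩`. -/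
def pureForm (M : SelfMap D) (u v : Fin D → ℂ) : ℝ :=
  (star v ⬝ᵥ (M (vecMulVec u (star u)) *ᵥ v)).re

theorem pureForm_smul (M : SelfMap D) (a b : ℝ) (u v : Fin D → ℂ) :
    pureForm M ((a : ℂ) • u) ((b : ℂ) • v) = a ^ 2 * b ^ 2 * pureForm M u v := by
  have h : vecMulVec ((a : ℂ) • u) (star ((a : ℂ) • u)) = ((a ^ 2 : ℝ) : ℂ) • vecMulVec u (star u) := by
    ext i j
    simp [vecMulVec_apply]
    ring
  rw [pureForm, h, map_smul, Matrix.smul_mulVec, Matrix.mulVec_smul, star_smul]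
  simp only [smul_dotProduct, dotProduct_smul, smul_eq_mul, RCLike.star_def, Complex.conj_ofReal,
    Complex.re_ofReal_mul, pureForm]
  ring

theorem continuous_pureForm (M : SelfMap D) :
    Continuous fun p : (Fin D → ℂ) × (Fin D → ℂ) => pureForm M p.1 p.2 := by
  have hM : Continuous M := M.continuous_of_finiteDimensional
  have h1 : Continuous fun p : (Fin D → ℂ) × (Fin D → ℂ) => vecMulVec p.1 (star p.1) :=
    continuous_fst.matrix_vecMulVec continuous_fst.star
  exact Complex.continuous_re.comp
    (continuous_snd.star.dotProduct ((hM.comp h1).matrix_mulVec continuous_snd))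

theorem pureForm_pos {M : SelfMap D} (hM : IsStrictlyPositiveMap M) {u v : Fin D → ℂ}
    (hu : ∑ i, ‖u i‖ ^ 2 = 1) (hv : ∑ i, ‖v i‖ ^ 2 = 1) : 0 < pureForm M u v := by
  have hρ : IsDensity (vecMulVec u (star u)) :=
    ⟨Matrix.posSemidef_vecMulVec_self_star u, by rw [trace_vecMulVec_star, hu, Complex.ofReal_one]⟩
  have hv0 : v ≠ 0 := by
    rintro rfl
    simp at hv
  exact (Complex.lt_def.1 ((hM _ hρ).dotProduct_mulVec_pos hv0)).1

/-- A map that sends every positive semidefinite `X` to an operator between `κ Tr X` and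
`κ⁻¹ Tr X`. -/
def IsTraceSqueezed (κ : ℝ) (M : SelfMap D) : Prop :=
  ∀ X : Matrix (Fin D) (Fin D) ℂ, X.PosSemidef →
    (M X - ((κ * X.trace.re : ℝ) : ℂ) • 1).PosSemidef ∧
    (((κ⁻¹ * X.trace.re : ℝ) : ℂ) • 1 - M X).PosSemidef

theorem posSemidef_of_re_nonneg {X : Matrix (Fin D) (Fin D) ℂ} (hX : X.IsHermitian)
    (h : ∀ v, 0 ≤ (star v ⬝ᵥ (X *ᵥ v)).re) : X.PosSemidef := by
  refine Matrix.PosSemidef.of_dotProduct_mulVec_nonneg hX fun v => ?_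
  exact Complex.le_def.2 ⟨h v, (hX.im_star_dotProduct_mulVec_self v).symm⟩

/-- On pairs of unit vectors the continuous function `pureForm M` has a positive minimum and a
finite maximum; any `κ` below the minimum and below the inverse of the maximum works. Stating this
for all small `κ` allows finitely many maps to share one value. -/
theorem eventually_isTraceSqueezed (hD : 0 < D) {M : SelfMap D} (hM : IsStrictlyPositiveMap M)
    (hpos : ∀ X : Matrix (Fin D) (Fin D) ℂ, X.PosSemidef → (M X).PosSemidef) :
    ∀ᶠ κ in 𝓝[>] (0 : ℝ), IsTraceSqueezed κ M := by
  set S := {u : Fin D → ℂ | ∑ i, ‖u i‖ ^ 2 = 1}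
  have hSc : IsCompact (S ×ˢ S) := isCompact_unit_vectors.prod isCompact_unit_vectors
  have hSn : (S ×ˢ S).Nonempty := by
    have : (Pi.single ⟨0, hD⟩ 1 : Fin D → ℂ) ∈ S := by
      simp only [S, Set.mem_ofPred_eq]
      rw [Finset.sum_eq_single ⟨0, hD⟩] <;> simp +contextual
    exact ⟨(_, _), this, this⟩
  obtain ⟨p, hp, hmin⟩ := hSc.exists_isMinOn hSn (continuous_pureForm M).continuousOn
  obtain ⟨r, hr, hmax⟩ := hSc.exists_isMaxOn hSn (continuous_pureForm M).continuousOn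
  have hp0 : 0 < pureForm M p.1 p.2 := pureForm_pos hM hp.1 hp.2
  have hr0 : 0 < pureForm M r.1 r.2 := pureForm_pos hM hr.1 hr.2
  filter_upwards [self_mem_nhdsWithin,
    mem_nhdsWithin_of_mem_nhds (Iio_mem_nhds hp0),
    mem_nhdsWithin_of_mem_nhds (Iio_mem_nhds (inv_pos.2 hr0))] with κ hκ0 hκp hκr
  have hκ0 : 0 < κ := hκ0
  have hκp : κ < pureForm M p.1 p.2 := hκp
  have hκr : pureForm M r.1 r.2 ≤ κ⁻¹ := ((lt_inv_comm₀ hκ0 hr0).1 hκr).le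
  have hbound : ∀ u v : Fin D → ℂ,
      κ * (∑ i, ‖u i‖ ^ 2) * (∑ i, ‖v i‖ ^ 2) ≤ pureForm M u v ∧
      pureForm M u v ≤ κ⁻¹ * (∑ i, ‖u i‖ ^ 2) * (∑ i, ‖v i‖ ^ 2) := by
    have hnorm : ∀ u : Fin D → ℂ, ∃ (a : ℝ) (w : Fin D → ℂ), w ∈ S ∧ u = (a : ℂ) • w := by
      intro u
      by_cases hu : ∑ i, ‖u i‖ ^ 2 = 0
      · refine ⟨0, p.1, hp.1, ?_⟩
        rw [Finset.sum_eq_zero_iff_of_nonneg fun _ _ => sq_nonneg _] at hu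
        ext i
        simpa using hu i (Finset.mem_univ i)
      · have h0 : 0 < ∑ i, ‖u i‖ ^ 2 :=
          lt_of_le_of_ne (Finset.sum_nonneg fun _ _ => sq_nonneg _) (Ne.symm hu)
        have hs := Real.sqrt_pos.2 h0
        refine ⟨√(∑ i, ‖u i‖ ^ 2), (((√(∑ i, ‖u i‖ ^ 2))⁻¹ : ℝ) : ℂ) • u, ?_, ?_⟩
        · simp only [S, Set.mem_ofPred_eq, Pi.smul_apply, norm_smul, mul_pow, ← Finset.mul_sum,
            Complex.norm_real, Real.norm_eq_abs, sq_abs, inv_pow, Real.sq_sqrt h0.le]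
          exact inv_mul_cancel₀ hu
        · rw [smul_smul, ← Complex.ofReal_mul, mul_inv_cancel₀ hs.ne', Complex.ofReal_one, one_smul]
    intro u v
    obtain ⟨a, u, hu, rfl⟩ := hnorm u
    obtain ⟨b, v, hv, rfl⟩ := hnorm v
    have hsum : ∀ (a : ℝ) (u : Fin D → ℂ), u ∈ S → ∑ i, ‖((a : ℂ) • u) i‖ ^ 2 = a ^ 2 := by
      intro a u hu
      simp only [Pi.smul_apply, norm_smul, mul_pow, ← Finset.mul_sum, Complex.norm_real,
        Real.norm_eq_abs, sq_abs]
      rw [show ∑ i, ‖u i‖ ^ 2 = 1 from hu, mul_one]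
    rw [pureForm_smul, hsum a u hu, hsum b v hv]
    have h1 : pureForm M p.1 p.2 ≤ pureForm M u v := hmin (a := (u, v)) ⟨hu, hv⟩
    have h2 : pureForm M u v ≤ pureForm M r.1 r.2 := hmax (a := (u, v)) ⟨hu, hv⟩
    have hab : 0 ≤ a ^ 2 * b ^ 2 := by positivity
    constructor
    · calc κ * a ^ 2 * b ^ 2 = a ^ 2 * b ^ 2 * κ := by ring
        _ ≤ _ := mul_le_mul_of_nonneg_left (hκp.le.trans h1) hab
    · calc a ^ 2 * b ^ 2 * pureForm M u v ≤ a ^ 2 * b ^ 2 * κ⁻¹ :=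
          mul_le_mul_of_nonneg_left (h2.trans hκr) hab
        _ = _ := by ring
  intro X hX
  have hMX := (hpos X hX).isHermitian
  have hherm : ∀ c : ℝ, ((c : ℂ) • (1 : Matrix (Fin D) (Fin D) ℂ)).IsHermitian :=
    fun c => Matrix.isHermitian_one.ofReal_smul c
  -- The bounds on rank-one operators extend by linearity, `X` being a sum of such operators.
  obtain ⟨B, hB⟩ := posSemidef_eq_sum_vecMulVec hX
  have htr : X.trace.re = ∑ k, ∑ i, ‖B k i‖ ^ 2 := by
    rw [hB, Matrix.trace_sum, Complex.re_sum]
    simp only [trace_vecMulVec_star, Complex.ofReal_re]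
  have hform : ∀ v, (star v ⬝ᵥ (M X *ᵥ v)).re = ∑ k, pureForm M (B k) v := by
    intro v
    rw [hB, map_sum, Matrix.sum_mulVec, dotProduct_sum, Complex.re_sum]
    rfl
  have hone : ∀ (c : ℝ) (v : Fin D → ℂ),
      (star v ⬝ᵥ (((c : ℂ) • (1 : Matrix (Fin D) (Fin D) ℂ)) *ᵥ v)).re =
        c * ∑ i, ‖v i‖ ^ 2 := by
    intro c v
    rw [Matrix.smul_mulVec, Matrix.one_mulVec, dotProduct_smul, dotProduct_star_self_eq,
      smul_eq_mul, ← Complex.ofReal_mul, Complex.ofReal_re]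
  constructor
  · refine posSemidef_of_re_nonneg (hMX.sub (hherm _)) fun v => ?_
    rw [Matrix.sub_mulVec, dotProduct_sub, Complex.sub_re, hform, hone, htr, sub_nonneg]
    have h := Finset.sum_le_sum fun k (_ : k ∈ Finset.univ) => (hbound (B k) v).1
    rw [← Finset.sum_mul, ← Finset.mul_sum] at h
    exact h
  · refine posSemidef_of_re_nonneg ((hherm _).sub hMX) fun v => ?_
    rw [Matrix.sub_mulVec, dotProduct_sub, Complex.sub_re, hform, hone, htr, sub_nonneg]
    have h := Finset.sum_le_sum fun k (_ : k ∈ Finset.univ) => (hbound (B k) v).2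
    rw [← Finset.sum_mul, ← Finset.mul_sum] at h
    exact h

end StrictlyPositive

/-! ### Contraction of the oscillation -/

section Oscillation

variable {D d : ℕ}

theorem re_trace_nonneg {n : Type*} [Fintype n] {X : Matrix n n ℂ} (hX : X.PosSemidef) :
    0 ≤ X.trace.re :=
  (Complex.le_def.1 hX.trace_nonneg).1

theorem ofReal_re_trace {n : Type*} [Fintype n] {X : Matrix n n ℂ} (hX : X.PosSemidef) :
    ((X.trace.re : ℝ) : ℂ) = X.trace :=
  (Complex.eq_re_of_ofReal_le (r := 0) (by rw [Complex.ofReal_zero]; exact hX.trace_nonneg)).symm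

theorem Matrix.PosSemidef.ofReal_smul {n : Type*} {X : Matrix n n ℂ} (hX : X.PosSemidef) {c : ℝ}
    (hc : 0 ≤ c) : ((c : ℂ) • X).PosSemidef :=
  hX.smul (Complex.zero_le_real.2 hc)

theorem re_trace_sub_smul {n : Type*} [Fintype n] (X Y : Matrix n n ℂ) (c : ℝ) :
    (X - (c : ℂ) • Y).trace.re = X.trace.re - c * Y.trace.re := by
  simp [Matrix.trace_sub, Matrix.trace_smul]

theorem re_trace_smul_sub {n : Type*} [Fintype n] (X Y : Matrix n n ℂ) (c : ℝ) :
    ((c : ℂ) • Y - X).trace.re = c * Y.trace.re - X.trace.re := by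
  simp [Matrix.trace_sub, Matrix.trace_smul]

theorem IsTraceSqueezed.re_trace_pos {κ : ℝ} {M : SelfMap D} (hM : IsTraceSqueezed κ M)
    (hD : 0 < D) (hκ : 0 < κ) {Y : Matrix (Fin D) (Fin D) ℂ} (hY : Y.PosSemidef)
    (hy : 0 < Y.trace.re) : 0 < (M Y).trace.re := by
  have := re_trace_nonneg (hM Y hY).1
  rw [re_trace_sub_smul, Matrix.trace_one, Fintype.card_fin, Complex.natCast_re] at this
  have h : 0 < κ * Y.trace.re * D := by positivity
  linarith

/-- `M[Y]` is bounded from below by a multiple of its trace. -/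
theorem IsTraceSqueezed.sub_smul_one_posSemidef {κ : ℝ} {M : SelfMap D}
    (hM : IsTraceSqueezed κ M) (hD : 0 < D) (hκ : 0 < κ) {Y : Matrix (Fin D) (Fin D) ℂ}
    (hY : Y.PosSemidef) :
    (M Y - ((κ ^ 2 / D * (M Y).trace.re : ℝ) : ℂ) • 1).PosSemidef := by
  have h1 := (hM Y hY).1
  have h2 := re_trace_nonneg (hM Y hY).2
  rw [re_trace_smul_sub, Matrix.trace_one, Fintype.card_fin, Complex.natCast_re] at h2
  have hD' : (0 : ℝ) < D := by exact_mod_cast hD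
  have h3 : 0 ≤ κ * Y.trace.re - κ ^ 2 / D * (M Y).trace.re := by
    have h4 : κ ^ 2 / D * (M Y).trace.re ≤ κ ^ 2 / D * (κ⁻¹ * Y.trace.re * D) :=
      mul_le_mul_of_nonneg_left (by linarith) (by positivity)
    have h5 : κ ^ 2 / D * (κ⁻¹ * Y.trace.re * D) = κ * Y.trace.re := by
      field_simp
    linarith
  have := h1.add ((Matrix.PosSemidef.one (n := Fin D) (R := ℂ)).ofReal_smul h3)
  convert this using 1
  push_cast
  module

/-- Both images are compared with the identity: `M Z ≥ κ Tr Z` and `M Y ≤ κ⁻¹ Tr Y`. The two losses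
combine into `κ ^ 2`. -/
theorem IsTraceSqueezed.sub_smul_posSemidef {κ : ℝ} {M : SelfMap D} (hM : IsTraceSqueezed κ M)
    (hκ : 0 < κ) {Z Y : Matrix (Fin D) (Fin D) ℂ} (hZ : Z.PosSemidef) (hY : Y.PosSemidef)
    (hy : 0 < Y.trace.re) :
    (M Z - ((κ ^ 2 * (Z.trace.re / Y.trace.re) : ℝ) : ℂ) • M Y).PosSemidef := by
  have hz := re_trace_nonneg hZ
  have h := (hM Z hZ).1.add ((hM Y hY).2.ofReal_smul
    (c := κ ^ 2 * (Z.trace.re / Y.trace.re)) (by positivity))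
  convert h using 1
  have h3 : κ ^ 2 * (Z.trace.re / Y.trace.re) * (κ⁻¹ * Y.trace.re) = κ * Z.trace.re := by
    field_simp
  rw [smul_sub, smul_smul, ← Complex.ofReal_mul, h3]
  abel

/-- One step of Hopf's oscillation argument. -/
theorem IsTraceSqueezed.contract {κ : ℝ} {M : SelfMap D} (hM : IsTraceSqueezed κ M)
    (hκ : 0 < κ) {X Y : Matrix (Fin D) (Fin D) ℂ} (hY : Y.PosSemidef) (hy : 0 < Y.trace.re)
    {a b : ℝ} (ha : (X - (a : ℂ) • Y).PosSemidef) (hb : ((b : ℂ) • Y - X).PosSemidef) :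
    ∃ a' b' : ℝ, a ≤ a' ∧ b' - a' = (1 - κ ^ 2) * (b - a) ∧
      (M X - (a' : ℂ) • M Y).PosSemidef ∧ ((b' : ℂ) • M Y - M X).PosSemidef := by
  have h1 := hM.sub_smul_posSemidef hκ ha hY hy
  have h2 := hM.sub_smul_posSemidef hκ hb hY hy
  have ha0 := re_trace_nonneg ha
  -- The gaps `X - a Y` and `b Y - X` are themselves positive, so their images dominate multiples of
  -- `M Y`, which are moved into the bounds. Their traces add up to `(b - a) Tr Y`, whence the exact
  -- factor `1 - κ ^ 2`.
  refine ⟨a + κ ^ 2 * ((X - (a : ℂ) • Y).trace.re / Y.trace.re),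
    b - κ ^ 2 * (((b : ℂ) • Y - X).trace.re / Y.trace.re), ?_, ?_, ?_, ?_⟩
  · have : 0 ≤ κ ^ 2 * ((X - (a : ℂ) • Y).trace.re / Y.trace.re) := by positivity
    linarith
  · rw [re_trace_sub_smul, re_trace_smul_sub]
    field_simp
    ring
  · convert h1 using 1
    rw [map_sub, map_smul]
    push_cast
    module
  · convert h2 using 1
    rw [map_sub, map_smul]
    push_cast
    module

/-- Splitting a word. -/
theorem wordMap_add (N : YMap D d) (m k : ℕ) (b : Fin (m + k) → Fin d) :
    wordMap N (m + k) b =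
      wordMap N k (fun i => b (Fin.natAdd m i)) ∘ₗ wordMap N m (fun i => b (Fin.castAdd k i)) := by
  induction k with
  | zero => rfl
  | succ k ih =>
    change outcomeMap N _ ∘ₗ wordMap N (m + k) (Fin.init b) = _
    rw [ih]
    rfl

/-- The maps of all sufficiently long words contract the oscillation exponentially. -/
structure IsContracting (N : YMap D d) (ξ : ℕ) (δ C q : ℝ) : Prop where
  exists_bounds : ∀ ℓ, ξ ≤ ℓ → ∀ (w : Fin ℓ → Fin d) (X : Matrix (Fin D) (Fin D) ℂ),
    X.PosSemidef → ∃ a b : ℝ, δ * X.trace.re ≤ a ∧ b - a ≤ C * q ^ ℓ * X.trace.re ∧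
      (wordMap N ℓ w X - (a : ℂ) • wordMap N ℓ w 1).PosSemidef ∧
      ((b : ℂ) • wordMap N ℓ w 1 - wordMap N ℓ w X).PosSemidef
  lower_bound : ∀ ℓ, ξ ≤ ℓ → ∀ w : Fin ℓ → Fin d,
    (wordMap N ℓ w 1 - ((δ * (wordMap N ℓ w 1).trace.re : ℝ) : ℂ) • 1).PosSemidef
  trace_pos : ∀ ℓ, ξ ≤ ℓ → ∀ w : Fin ℓ → Fin d, 0 < (wordMap N ℓ w 1).trace.re

theorem exists_uniform_isTraceSqueezed {N : YMap D d} (hD : 0 < D) {ξ : ℕ}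
    (h : ∀ ℓ, ξ ≤ ℓ → ∀ t : Fin ℓ → Fin d, IsStrictlyPositiveMap (wordMap N ℓ t)) (n : ℕ) :
    ∃ κ : ℝ, 0 < κ ∧ κ < 1 ∧ ∀ ℓ, ξ ≤ ℓ → ℓ < n → ∀ t : Fin ℓ → Fin d,
      IsTraceSqueezed κ (wordMap N ℓ t) := by
  have h1 : ∀ᶠ κ in nhdsWithin (0 : ℝ) (Set.Ioi 0), ∀ (ℓ : Fin n) (t : Fin ℓ → Fin d), ξ ≤ ℓ →
      IsTraceSqueezed κ (wordMap N ℓ t) := by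
    rw [Filter.eventually_all]
    intro ℓ
    rw [Filter.eventually_all]
    intro t
    by_cases hξ : ξ ≤ ℓ
    · filter_upwards [eventually_isTraceSqueezed hD (h ℓ hξ t)
        fun X hX => posSemidef_wordMap N t hX] with κ hκ _ using hκ
    · exact Filter.Eventually.of_forall fun κ h => absurd h hξ
  have h2 : ∀ᶠ κ in nhdsWithin (0 : ℝ) (Set.Ioi 0), κ ∈ Set.Iio (1 : ℝ) :=
    mem_nhdsWithin_of_mem_nhds (Iio_mem_nhds one_pos)
  obtain ⟨κ, ⟨hκ, hκ1⟩, hκ0⟩ := ((h1.and h2).and self_mem_nhdsWithin).exists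
  exact ⟨κ, hκ0, hκ1, fun ℓ hξ hn t => hκ ⟨ℓ, hn⟩ t hξ⟩

/-- Lengths in `[ξ, 2ξ)` are the base of a strong induction; a longer word is split into a prefix of
length at least `ξ` and its last `ξ` letters, which contract the oscillation. Only words shorter
than `2ξ` determine `κ`, so the constants are uniform. -/
theorem exists_isContracting {N : YMap D d} (hD : 0 < D) (h : PositivityCondition N) :
    ∃ (ξ : ℕ) (δ C q : ℝ), 0 < δ ∧ 0 < C ∧ 0 < q ∧ q < 1 ∧ IsContracting N ξ δ C q := by
  obtain ⟨ξ₀, hξ₀⟩ := h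
  -- The shift makes `ξ` positive, so that removing `ξ` letters shortens the word and `κ ^ 2 / ξ` is
  -- meaningful.
  set ξ := ξ₀ + 1 with hξ_def
  have hξ : 0 < ξ := Nat.succ_pos _
  have h : ∀ ℓ, ξ ≤ ℓ → ∀ t : Fin ℓ → Fin d, IsStrictlyPositiveMap (wordMap N ℓ t) :=
    fun ℓ hℓ => hξ₀ ℓ (by omega)
  clear_value ξ
  obtain ⟨κ, hκ, hκ1, hsq⟩ := exists_uniform_isTraceSqueezed hD h (2 * ξ)
  have hD' : (0 : ℝ) < D := by exact_mod_cast hD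
  have hξ' : (1 : ℝ) ≤ ξ := by exact_mod_cast hξ
  have hκ2 : κ ^ 2 < 1 := pow_lt_one₀ hκ.le hκ1 two_ne_zero
  set q : ℝ := 1 - κ ^ 2 / ξ with hq_def
  have hdiv : κ ^ 2 / ξ ≤ κ ^ 2 := div_le_self (sq_nonneg κ) hξ'
  have hdiv0 : 0 < κ ^ 2 / ξ := by positivity
  have hq0 : 0 < q := by rw [hq_def]; linarith
  have hq1 : q < 1 := by rw [hq_def]; linarith
  -- Bernoulli's inequality: the choice of `q` turns a factor `1 - κ ^ 2` per `ξ` letters into a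
  -- factor `q` per letter, without a `ξ`-th root.
  have hqξ : 1 - κ ^ 2 ≤ q ^ ξ := by
    have := one_add_mul_le_pow (a := -(κ ^ 2 / ξ)) (by linarith) ξ
    calc 1 - κ ^ 2 = 1 + ξ * -(κ ^ 2 / ξ) := by field_simp; ring
      _ ≤ _ := this
      _ = q ^ ξ := by rw [hq_def, sub_eq_add_neg]
  -- The factor `(q ^ (2 * ξ))⁻¹` compensates `q ^ ℓ` for the base lengths `ℓ < 2 * ξ`.
  set C : ℝ := (κ ^ 2 * D)⁻¹ * (q ^ (2 * ξ))⁻¹ with hC_def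
  have hC : 0 < C := by positivity
  have hone : (1 : Matrix (Fin D) (Fin D) ℂ).PosSemidef := Matrix.PosSemidef.one
  have htr1 : (1 : Matrix (Fin D) (Fin D) ℂ).trace.re = D := by simp
  have htr1' : 0 < (1 : Matrix (Fin D) (Fin D) ℂ).trace.re := htr1 ▸ hD'
  have htrace : ∀ ℓ, ξ ≤ ℓ → ∀ w : Fin ℓ → Fin d, 0 < (wordMap N ℓ w 1).trace.re := by
    intro ℓ
    induction ℓ using Nat.strong_induction_on with
    | _ ℓ ih =>
      intro hℓ w
      by_cases hlt : ℓ < 2 * ξ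
      · exact (hsq ℓ hℓ hlt w).re_trace_pos hD hκ hone htr1'
      · obtain ⟨m, rfl⟩ : ∃ m, ℓ = m + ξ := ⟨ℓ - ξ, by omega⟩
        rw [wordMap_add]
        exact (hsq ξ le_rfl (by omega) _).re_trace_pos hD hκ (posSemidef_wordMap N _ hone)
          (ih m (by omega) (by omega) _)
  refine ⟨ξ, κ ^ 2 / D, C, q, by positivity, hC, hq0, hq1, ⟨?_, ?_, htrace⟩⟩
  · intro ℓ
    induction ℓ using Nat.strong_induction_on with
    | _ ℓ ih =>
      intro hℓ w X hX
      have hx := re_trace_nonneg hX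
      by_cases hlt : ℓ < 2 * ξ
      · have hM := hsq ℓ hℓ hlt w
        have h1 := hM.sub_smul_posSemidef hκ hX hone htr1'
        rw [htr1] at h1
        -- Comparing `X` with `1` gives the lower constant, and comparing `1` with `X` gives the
        -- upper one; the latter divides by `Tr X`, so `X = 0` is treated apart.
        refine ⟨_, (κ ^ 2 * D)⁻¹ * X.trace.re, le_of_eq (by ring), ?_, h1, ?_⟩
        · have h2 : (κ ^ 2 * D)⁻¹ ≤ C * q ^ ℓ := by
            have h3 : q ^ (2 * ξ) ≤ q ^ ℓ := pow_le_pow_of_le_one hq0.le hq1.le hlt.le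
            rw [hC_def, mul_assoc]
            refine le_mul_of_one_le_right (by positivity) ?_
            rw [inv_mul_eq_div, one_le_div (by positivity)]
            exact h3
          have h4 := mul_le_mul_of_nonneg_right h2 hx
          have h5 : 0 ≤ κ ^ 2 * (X.trace.re / D) := by positivity
          linarith
        · rcases hx.eq_or_lt with hx0 | hx0
          · have hX0 : X = 0 := by
              rw [← hX.trace_eq_zero_iff, ← ofReal_re_trace hX, ← hx0, Complex.ofReal_zero]
            simp [hX0, Matrix.PosSemidef.zero]
          · have h2 := (hM.sub_smul_posSemidef hκ hone hX hx0).ofReal_smul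
              (c := (κ ^ 2 * D)⁻¹ * X.trace.re) (by positivity)
            convert h2 using 1
            rw [smul_sub, smul_smul, ← Complex.ofReal_mul, htr1]
            have h3 : (κ ^ 2 * D)⁻¹ * X.trace.re * (κ ^ 2 * (D / X.trace.re)) = 1 := by
              field_simp
            rw [h3, Complex.ofReal_one, one_smul]
      · obtain ⟨m, rfl⟩ : ∃ m, ℓ = m + ξ := ⟨ℓ - ξ, by omega⟩
        rw [wordMap_add]
        obtain ⟨a, b, ha, hab, h1, h2⟩ := ih m (by omega) (by omega)
          (fun i => w (Fin.castAdd ξ i)) X hX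
        obtain ⟨a', b', haa', hba', h1', h2'⟩ :=
          (hsq ξ le_rfl (by omega) fun i => w (Fin.natAdd m i)).contract hκ
            (posSemidef_wordMap N _ hone) (htrace m (by omega) _) h1 h2
        refine ⟨a', b', ha.trans haa', ?_, h1', h2'⟩
        rw [hba']
        have h0 : 0 ≤ 1 - κ ^ 2 := by linarith
        calc (1 - κ ^ 2) * (b - a) ≤ (1 - κ ^ 2) * (C * q ^ m * X.trace.re) :=
              mul_le_mul_of_nonneg_left hab h0
          _ ≤ q ^ ξ * (C * q ^ m * X.trace.re) :=
              mul_le_mul_of_nonneg_right hqξ (by positivity)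
          _ = C * q ^ (m + ξ) * X.trace.re := by rw [pow_add]; ring
  · intro ℓ hℓ w
    obtain ⟨m, rfl⟩ : ∃ m, ℓ = m + ξ := ⟨ℓ - ξ, by omega⟩
    rw [wordMap_add]
    exact (hsq ξ le_rfl (by omega) _).sub_smul_one_posSemidef hD hκ (posSemidef_wordMap N _ hone)

end Oscillation

/-! ### Decay of the mutual information -/

section Decay

variable {D d : ℕ}

theorem norm_apply_le_re_trace {n : Type*} [Fintype n] [DecidableEq n] {P : Matrix n n ℂ}
    (hP : P.PosSemidef) (x y : n) : ‖P x y‖ ≤ P.trace.re := by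
  obtain ⟨B, hB⟩ := posSemidef_eq_sum_vecMulVec hP
  have htr : P.trace.re = ∑ k, ∑ i, ‖B k i‖ ^ 2 := by
    rw [hB, Matrix.trace_sum, Complex.re_sum]
    simp only [trace_vecMulVec_star, Complex.ofReal_re]
  rw [htr, hB, Matrix.sum_apply]
  refine (norm_sum_le _ _).trans (Finset.sum_le_sum fun k _ => ?_)
  have h : ∀ z, ‖B k z‖ ^ 2 ≤ ∑ i, ‖B k i‖ ^ 2 := fun z =>
    Finset.single_le_sum (f := fun i => ‖B k i‖ ^ 2) (fun _ _ => sq_nonneg _) (Finset.mem_univ z)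
  rw [vecMulVec_apply, norm_mul, Pi.star_apply, norm_star]
  nlinarith [h x, h y, sq_nonneg (‖B k x‖ - ‖B k y‖)]

/-- The deviation `X ↦ W[X] - (Tr W[X] / Tr W[1]) W[1]` of `W` from a map of rank one. -/
def deviation (W : SelfMap D) : SelfMap D :=
  W - (Matrix.traceLinearMap (Fin D) ℂ ℂ ∘ₗ W).smulRight ((W 1).trace⁻¹ • W 1)

theorem deviation_apply (W : SelfMap D) (X : Matrix (Fin D) (Fin D) ℂ) :
    deviation W X = W X - ((W X).trace * (W 1).trace⁻¹) • W 1 := by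
  simp [deviation, smul_smul]

theorem one_eq_sum_single {n : Type*} [Fintype n] [DecidableEq n] :
    (1 : Matrix n n ℂ) = ∑ i, Matrix.single i i 1 := by
  rw [Matrix.matrix_eq_sum_single (1 : Matrix n n ℂ)]
  refine Finset.sum_congr rfl fun i _ => ?_
  rw [Finset.sum_eq_single i] <;> simp +contextual [eq_comm]

theorem single_eq_polarization {n : Type*} [DecidableEq n] (i j : n) :
    Matrix.single i j (1 : ℂ) = (1 / 4 : ℂ) • ∑ k : Fin 4, (Complex.I ^ (k : ℕ)) •
      vecMulVec (Pi.single i 1 + Complex.I ^ (k : ℕ) • Pi.single j 1)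
        (star (Pi.single i 1 + Complex.I ^ (k : ℕ) • Pi.single j 1)) := by
  ext x y
  have hI : Complex.I * Complex.I = -1 := Complex.I_mul_I
  have hs : ∀ k z : n, (starRingEnd ℂ) ((Pi.single k 1 : n → ℂ) z) = (Pi.single k 1 : n → ℂ) z := by
    intro k z
    by_cases h : z = k
    · subst h; simp
    · simp [h]
  have h1 : Matrix.single i j (1 : ℂ) x y = (Pi.single i 1 : n → ℂ) x * (Pi.single j 1 : n → ℂ) y := by
    simp only [Matrix.single_apply, Pi.single_apply, eq_comm (a := x), eq_comm (a := y)]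
    split_ifs <;> simp_all
  rw [h1]
  simp only [Fin.sum_univ_four, Matrix.smul_apply, Matrix.add_apply, vecMulVec_apply, Pi.add_apply,
    Pi.smul_apply, Pi.star_apply, smul_eq_mul, RCLike.star_def, map_add, map_mul, map_pow, hs,
    Complex.conj_I]
  norm_num [Complex.I_sq, pow_succ]
  ring_nf
  norm_num [Complex.I_sq, Complex.I_pow_four, pow_succ]
  ring

/-- The deviation is `W X - a W 1` minus a nonnegative multiple of `W 1`. Both terms are positive
semidefinite with the same trace, at most `(b - a) Tr W[1]`, and this trace bounds their entries. -/
theorem norm_deviation_apply_le {W : SelfMap D}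
    (hW : ∀ X : Matrix (Fin D) (Fin D) ℂ, X.PosSemidef → (W X).PosSemidef)
    (ht : 0 < (W 1).trace.re) {X : Matrix (Fin D) (Fin D) ℂ} (hX : X.PosSemidef) {a b : ℝ}
    (ha : (W X - (a : ℂ) • W 1).PosSemidef) (hb : ((b : ℂ) • W 1 - W X).PosSemidef) (x y : Fin D) :
    ‖deviation W X x y‖ ≤ 2 * (b - a) * (W 1).trace.re := by
  have h1 : (1 : Matrix (Fin D) (Fin D) ℂ).PosSemidef := Matrix.PosSemidef.one
  set t := (W 1).trace.re with ht_def
  set w := (W X).trace.re with hw_def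
  have hat := re_trace_nonneg ha
  have hbt := re_trace_nonneg hb
  rw [re_trace_sub_smul] at hat
  rw [re_trace_smul_sub] at hbt
  have hdev : deviation W X = (W X - (a : ℂ) • W 1) - ((w / t - a : ℝ) : ℂ) • W 1 := by
    rw [deviation_apply, ← ofReal_re_trace (hW X hX), ← ofReal_re_trace (hW 1 h1), ← ht_def,
      ← hw_def]
    push_cast
    rw [div_eq_mul_inv]
    module
  have h2 := norm_apply_le_re_trace ha x y
  rw [re_trace_sub_smul] at h2
  have h3 := norm_apply_le_re_trace (hW 1 h1) x y
  have h4 : 0 ≤ w / t - a := by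
    rw [sub_nonneg, le_div_iff₀ ht]
    linarith
  rw [hdev, Matrix.sub_apply, Matrix.smul_apply, smul_eq_mul]
  refine (norm_sub_le _ _).trans ?_
  rw [norm_mul, Complex.norm_real, Real.norm_of_nonneg h4]
  have h5 : (w / t - a) * ‖W 1 x y‖ ≤ (w / t - a) * t := mul_le_mul_of_nonneg_left h3 h4
  have h6 : (w / t - a) * t = w - a * t := by field_simp
  linarith

/-- Contraction is known on positive operators only. Polarization writes a matrix unit as an
average, with unimodular phases, of four rank-one positive operators of trace at most `4`; with the
factor `2` of the previous bound this gives `8`. -/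
theorem IsContracting.norm_deviation_single_le {N : YMap D d} {ξ : ℕ} {δ C q : ℝ}
    (h : IsContracting N ξ δ C q) (hC : 0 < C) (hq : 0 < q) {ℓ : ℕ} (hℓ : ξ ≤ ℓ)
    (w : Fin ℓ → Fin d) (i j x y : Fin D) :
    ‖deviation (wordMap N ℓ w) (Matrix.single i j 1) x y‖ ≤
      8 * C * q ^ ℓ * (wordMap N ℓ w 1).trace.re := by
  set W := wordMap N ℓ w
  set t := (W 1).trace.re
  have ht : 0 < t := h.trace_pos ℓ hℓ w
  have hpure : ∀ u : Fin D → ℂ, ‖deviation W (vecMulVec u (star u)) x y‖ ≤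
      2 * (C * q ^ ℓ * ∑ i, ‖u i‖ ^ 2) * t := by
    intro u
    have hu := Matrix.posSemidef_vecMulVec_self_star u
    obtain ⟨a, b, -, hab, h1, h2⟩ := h.exists_bounds ℓ hℓ w _ hu
    rw [trace_vecMulVec_star, Complex.ofReal_re] at hab
    refine (norm_deviation_apply_le (fun X hX => posSemidef_wordMap N w hX) ht hu h1 h2 x y).trans ?_
    exact mul_le_mul_of_nonneg_right (mul_le_mul_of_nonneg_left hab zero_le_two) ht.le
  have hs : ∀ k : Fin D, ∑ z, ‖(Pi.single k 1 : Fin D → ℂ) z‖ ^ 2 = 1 := by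
    intro k
    rw [Finset.sum_eq_single k] <;> simp +contextual
  have hnorm : ∀ k : Fin 4, ∑ z, ‖(Pi.single i 1 + Complex.I ^ (k : ℕ) • Pi.single j 1 :
      Fin D → ℂ) z‖ ^ 2 ≤ 4 := by
    intro k
    calc _ ≤ ∑ z, (2 * ‖(Pi.single i 1 : Fin D → ℂ) z‖ ^ 2 +
          2 * ‖(Pi.single j 1 : Fin D → ℂ) z‖ ^ 2) := by
          refine Finset.sum_le_sum fun z _ => ?_
          have h1 := norm_add_le ((Pi.single i 1 : Fin D → ℂ) z)
            ((Complex.I ^ (k : ℕ) • Pi.single j 1 : Fin D → ℂ) z)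
          have h2 : ‖(Complex.I ^ (k : ℕ) • Pi.single j 1 : Fin D → ℂ) z‖ =
              ‖(Pi.single j 1 : Fin D → ℂ) z‖ := by
            rw [Pi.smul_apply, norm_smul, norm_pow, Complex.norm_I, one_pow, one_mul]
          rw [h2] at h1
          rw [Pi.add_apply]
          nlinarith [norm_nonneg ((Pi.single i 1 : Fin D → ℂ) z +
            (Complex.I ^ (k : ℕ) • Pi.single j 1 : Fin D → ℂ) z),
            sq_nonneg (‖(Pi.single i 1 : Fin D → ℂ) z‖ - ‖(Pi.single j 1 : Fin D → ℂ) z‖)]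
      _ = 4 := by
          rw [Finset.sum_add_distrib, ← Finset.mul_sum, ← Finset.mul_sum, hs, hs]
          norm_num
  rw [single_eq_polarization, map_smul, map_sum, Matrix.smul_apply, Matrix.sum_apply, norm_smul]
  have hterm : ∀ k : Fin 4, ‖(deviation W ((Complex.I ^ (k : ℕ)) •
      vecMulVec (Pi.single i 1 + Complex.I ^ (k : ℕ) • Pi.single j 1)
        (star (Pi.single i 1 + Complex.I ^ (k : ℕ) • Pi.single j 1)))) x y‖ ≤
      8 * C * q ^ ℓ * t := by
    intro k
    rw [map_smul, Matrix.smul_apply, norm_smul, norm_pow, Complex.norm_I, one_pow, one_mul]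
    refine (hpure _).trans ?_
    have h0 : 0 ≤ C * q ^ ℓ := by positivity
    calc _ ≤ 2 * (C * q ^ ℓ * 4) * t :=
          mul_le_mul_of_nonneg_right (mul_le_mul_of_nonneg_left
            (mul_le_mul_of_nonneg_left (hnorm k) h0) zero_le_two) ht.le
      _ = _ := by ring
  have hsum := (norm_sum_le Finset.univ fun k : Fin 4 => (deviation W ((Complex.I ^ (k : ℕ)) •
      vecMulVec (Pi.single i 1 + Complex.I ^ (k : ℕ) • Pi.single j 1)
        (star (Pi.single i 1 + Complex.I ^ (k : ℕ) • Pi.single j 1)))) x y).trans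
    (Finset.sum_le_sum fun k _ => hterm k)
  rw [Finset.sum_const, Finset.card_univ, Fintype.card_fin, nsmul_eq_mul] at hsum
  have h4 : ‖(1 / 4 : ℂ)‖ = 1 / 4 := by norm_num
  rw [h4]
  push_cast at hsum
  linarith

/-! ### Entries and marginals of the post-measurement states -/

section OutcomeState

variable (N : YMap D d) {ℓ : ℕ} (b : Fin ℓ → Fin d)

theorem outcomeOp_apply (x y : Fin D × Fin D) :
    outcomeOp N b x y = (D : ℂ)⁻¹ * wordMap N ℓ b (Matrix.single x.1 y.1 1) x.2 y.2 := by
  have : (Matrix.of fun c c' => maxEntangled D (x.1, c) (y.1, c')) =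
      (D : ℂ)⁻¹ • Matrix.single x.1 y.1 1 := by
    ext c c'
    simp [maxEntangled, Matrix.single_apply]
  rw [outcomeOp, idTensor, Matrix.of_apply, this, map_smul, Matrix.smul_apply, smul_eq_mul]

theorem outcomeWeight_eq : outcomeWeight N b = (D : ℂ)⁻¹ * (wordMap N ℓ b 1).trace := by
  rw [outcomeWeight, Matrix.trace, Fintype.sum_prod_type, one_eq_sum_single, map_sum,
    Matrix.trace_sum, Finset.mul_sum]
  refine Finset.sum_congr rfl fun i _ => ?_
  rw [Matrix.trace, Finset.mul_sum]
  exact Finset.sum_congr rfl fun x _ => outcomeOp_apply N b _ _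

theorem outcomeState_apply (hD : 0 < D) (x y : Fin D × Fin D) :
    outcomeState N b x y =
      (wordMap N ℓ b 1).trace⁻¹ * wordMap N ℓ b (Matrix.single x.1 y.1 1) x.2 y.2 := by
  have hD' : (D : ℂ) ≠ 0 := by exact_mod_cast hD.ne'
  rw [outcomeState, normalized, Matrix.smul_apply, outcomeOp_apply,
    show (outcomeOp N b).trace = _ from outcomeWeight_eq N b, smul_eq_mul, mul_inv, inv_inv]
  field_simp

theorem traceSnd_outcomeState_apply (hD : 0 < D) (i j : Fin D) :
    traceSnd (outcomeState N b) i j =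
      (wordMap N ℓ b 1).trace⁻¹ * (wordMap N ℓ b (Matrix.single i j 1)).trace := by
  simp only [traceSnd, Matrix.of_apply, outcomeState_apply N b hD, ← Finset.mul_sum]
  rfl

theorem traceFst_outcomeState (hD : 0 < D) :
    traceFst (outcomeState N b) = (wordMap N ℓ b 1).trace⁻¹ • wordMap N ℓ b 1 := by
  ext x y
  simp only [traceFst, Matrix.of_apply, outcomeState_apply N b hD, ← Finset.mul_sum]
  rw [Matrix.smul_apply, smul_eq_mul]
  congr 1
  conv_rhs => rw [one_eq_sum_single, map_sum, Matrix.sum_apply]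

open scoped Kronecker in
theorem outcomeState_sub_kronecker_apply (hD : 0 < D) (x y : Fin D × Fin D) :
    (outcomeState N b - traceSnd (outcomeState N b) ⊗ₖ traceFst (outcomeState N b)) x y =
      (wordMap N ℓ b 1).trace⁻¹ *
        deviation (wordMap N ℓ b) (Matrix.single x.1 y.1 1) x.2 y.2 := by
  rw [Matrix.sub_apply, Matrix.kroneckerMap_apply, traceSnd_outcomeState_apply N b hD,
    traceFst_outcomeState N b hD, outcomeState_apply N b hD, deviation_apply, Matrix.sub_apply,
    Matrix.smul_apply, Matrix.smul_apply, smul_eq_mul, smul_eq_mul]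
  ring

/-- The maximally entangled state transposes operators from `A` to the input of `W`, hence the
conjugate of `v`. This lets lower bounds on `W[X]` bound the marginal on `A` from below. -/
theorem star_dotProduct_traceSnd_outcomeState (hD : 0 < D) (v : Fin D → ℂ) :
    star v ⬝ᵥ (traceSnd (outcomeState N b) *ᵥ v) =
      (wordMap N ℓ b 1).trace⁻¹ * (wordMap N ℓ b (vecMulVec (star v) v)).trace := by
  have : vecMulVec (star v) v = ∑ i, ∑ j, (star (v i) * v j) • Matrix.single i j (1 : ℂ) := by
    rw [Matrix.matrix_eq_sum_single (vecMulVec (star v) v)]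
    simp [vecMulVec_apply, Matrix.smul_single]
  rw [this, map_sum, Matrix.trace_sum, Finset.mul_sum]
  simp only [map_sum, map_smul, Matrix.trace_sum, Matrix.trace_smul, Finset.mul_sum, dotProduct,
    Matrix.mulVec, traceSnd_outcomeState_apply N b hD, Pi.star_apply, smul_eq_mul]
  exact Finset.sum_congr rfl fun i _ => Finset.sum_congr rfl fun j _ => by ring

end OutcomeState

theorem IsContracting.mutualInfo_le {N : YMap D d} (hD : 0 < D) {ξ : ℕ} {δ C q : ℝ}
    (h : IsContracting N ξ δ C q) (hδ : 0 < δ) (hC : 0 < C) (hq : 0 < q) {ℓ : ℕ} (hℓ : ξ ≤ ℓ)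
    (b : Fin ℓ → Fin d) (hb : outcomeWeight N b ≠ 0) :
    mutualInfo (outcomeState N b) ≤
      (D : ℝ) ^ 4 * (8 * C) ^ 2 / (δ ^ 2 * Real.log 2) * (q ^ 2) ^ ℓ := by
  have hlog : 0 < Real.log 2 := Real.log_pos one_lt_two
  have hone : (1 : Matrix (Fin D) (Fin D) ℂ).PosSemidef := Matrix.PosSemidef.one
  have hρ := posSemidef_outcomeState N b
  have ht := h.trace_pos ℓ hℓ b
  set t := (wordMap N ℓ b 1).trace.re with ht_def
  have htc : (wordMap N ℓ b 1).trace = (t : ℂ) :=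
    (ofReal_re_trace (posSemidef_wordMap N b hone)).symm
  have hcast : ((t : ℂ))⁻¹ = ((t⁻¹ : ℝ) : ℂ) := (Complex.ofReal_inv t).symm
  have hA : (traceSnd (outcomeState N b) - (δ : ℂ) • 1).PosSemidef := by
    refine posSemidef_of_re_nonneg
      (hρ.traceSnd.isHermitian.sub (Matrix.isHermitian_one.ofReal_smul δ)) fun v => ?_
    rw [Matrix.sub_mulVec, dotProduct_sub, Matrix.smul_mulVec, Matrix.one_mulVec, dotProduct_smul,
      dotProduct_star_self_eq, star_dotProduct_traceSnd_outcomeState N b hD, htc, hcast,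
      Complex.sub_re, Complex.re_ofReal_mul, smul_eq_mul, Complex.re_ofReal_mul, Complex.ofReal_re]
    have hX : (vecMulVec (star v) v).PosSemidef := Matrix.posSemidef_vecMulVec_star_self v
    have hXtr : (vecMulVec (star v) v).trace.re = ∑ i, ‖v i‖ ^ 2 := by
      have := trace_vecMulVec_star (star v)
      rw [star_star] at this
      rw [this, Complex.ofReal_re]
      simp
    obtain ⟨a, _, ha, -, h1, -⟩ := h.exists_bounds ℓ hℓ b _ hX
    have h2 := re_trace_nonneg h1
    rw [re_trace_sub_smul, ← ht_def] at h2
    rw [hXtr] at ha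
    rw [sub_nonneg, inv_mul_eq_div, le_div_iff₀ ht]
    have h3 := mul_le_mul_of_nonneg_right ha ht.le
    linarith
  have hCC : (traceFst (outcomeState N b) - (δ : ℂ) • 1).PosSemidef := by
    have h1 := (h.lower_bound ℓ hℓ b).ofReal_smul (inv_nonneg.2 ht.le)
    convert h1 using 1
    rw [traceFst_outcomeState N b hD, htc, hcast, Complex.ofReal_re, smul_sub,
      smul_smul, ← Complex.ofReal_mul, show t⁻¹ * (δ * t) = δ by field_simp]
  refine (_root_.mutualInfo_le hρ (trace_outcomeState N hb) hδ hA hCC).trans ?_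
  have hentry : ∀ g g' : Fin D × Fin D, ‖(outcomeState N b -
      kroneckerMap (· * ·) (traceSnd (outcomeState N b)) (traceFst (outcomeState N b))) g' g‖ ^ 2 ≤
      (8 * C * q ^ ℓ) ^ 2 := by
    intro g g'
    refine pow_le_pow_left₀ (norm_nonneg _) ?_ 2
    rw [outcomeState_sub_kronecker_apply N b hD, norm_mul, htc, norm_inv, Complex.norm_real,
      Real.norm_of_nonneg ht.le, inv_mul_eq_div, div_le_iff₀ ht]
    exact h.norm_deviation_single_le hC hq hℓ b _ _ _ _
  -- The matrix has `D ^ 4` entries.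
  have hsum := Finset.sum_le_sum fun g (_ : g ∈ (Finset.univ : Finset (Fin D × Fin D))) =>
    Finset.sum_le_sum fun g' (_ : g' ∈ (Finset.univ : Finset (Fin D × Fin D))) => hentry g g'
  simp only [Finset.sum_const, Finset.card_univ, Fintype.card_prod, Fintype.card_fin,
    nsmul_eq_mul] at hsum
  push_cast at hsum
  refine (div_le_div_of_nonneg_right hsum (by positivity)).trans (le_of_eq ?_)
  rw [← pow_mul, mul_comm 2 ℓ, pow_mul]
  ring

theorem OutcomeMIDecay.of_positivityCondition {N : YMap D d} (hD : 0 < D)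
    (h : PositivityCondition N) : ∃ c₀ c₁ : ℝ, 0 < c₀ ∧ 0 < c₁ ∧ OutcomeMIDecay N c₀ c₁ := by
  obtain ⟨ξ, δ, C, q, hδ, hC, hq, hq1, hcon⟩ := exists_isContracting hD h
  have hlog : 0 < Real.log 2 := Real.log_pos one_lt_two
  have hD' : (0 : ℝ) < D := by exact_mod_cast hD
  have hq2 : 0 < q ^ 2 := by positivity
  have hq21 : q ^ 2 < 1 := pow_lt_one₀ hq.le hq1 two_ne_zero
  set A := (D : ℝ) ^ 4 * (8 * C) ^ 2 / (δ ^ 2 * Real.log 2)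
  have hA : 0 < A := by positivity
  set R := ∑ ℓ ∈ Finset.range ξ, ∑ b : Fin ℓ → Fin d, |mutualInfo (outcomeState N b)|
  have hR : 0 ≤ R := Finset.sum_nonneg fun _ _ => Finset.sum_nonneg fun _ _ => abs_nonneg _
  have hexp : ∀ ℓ : ℕ, Real.exp (-(-Real.log (q ^ 2)) * ℓ) = (q ^ 2) ^ ℓ := by
    intro ℓ
    rw [neg_neg, mul_comm, Real.exp_nat_mul, Real.exp_log hq2]
  -- The decay rate comes from `q ^ 2`, as the mutual information is quadratic in the deviation. `R`
  -- bounds the mutual information of the finitely many words shorter than `ξ`, and `((q ^ 2) ^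
  -- ξ)⁻¹` offsets the decay at those lengths.
  refine ⟨A + R * ((q ^ 2) ^ ξ)⁻¹, -Real.log (q ^ 2), by positivity,
    neg_pos.2 (Real.log_neg hq2 hq21), fun ℓ b hb => ?_⟩
  rw [hexp]
  by_cases hℓ : ξ ≤ ℓ
  · refine (hcon.mutualInfo_le hD hδ hC hq hℓ b hb).trans ?_
    exact mul_le_mul_of_nonneg_right (le_add_of_nonneg_right (by positivity)) (by positivity)
  · have hℓ := not_le.1 hℓ
    have h1 : mutualInfo (outcomeState N b) ≤ R := by
      refine (le_abs_self _).trans ?_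
      refine (Finset.single_le_sum (f := fun b : Fin ℓ → Fin d =>
        |mutualInfo (outcomeState N b)|) (fun _ _ => abs_nonneg _) (Finset.mem_univ b)).trans ?_
      exact Finset.single_le_sum (f := fun ℓ => ∑ b : Fin ℓ → Fin d,
        |mutualInfo (outcomeState N b)|) (fun _ _ => Finset.sum_nonneg fun _ _ => abs_nonneg _)
        (Finset.mem_range.2 hℓ)
    have h2 : (q ^ 2) ^ ξ ≤ (q ^ 2) ^ ℓ := pow_le_pow_of_le_one hq2.le hq21.le hℓ.le
    have h3 : R ≤ R * ((q ^ 2) ^ ξ)⁻¹ * (q ^ 2) ^ ℓ := by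
      rw [mul_assoc]
      refine le_mul_of_one_le_right hR ?_
      rw [inv_mul_eq_div, one_le_div (by positivity)]
      exact h2
    have h4 : 0 ≤ A * (q ^ 2) ^ ℓ := by positivity
    rw [add_mul]
    linarith

end Decay

end

theorem mainTheorem2 (D d : ℕ) (hD : 0 < D) (hd : 0 < d) (N : YMap D d) :
    (KrausCondition N → PositivityCondition N) ∧
    (PositivityCondition N → ∃ c₀ c₁ : ℝ, 0 < c₀ ∧ 0 < c₁ ∧ OutcomeMIDecay N c₀ c₁) ∧
    (∀ c₀ c₁ : ℝ, 0 < c₀ → 0 < c₁ → OutcomeMIDecay N c₀ c₁ → MeasuredCMIDecay N c₀ c₁) :=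
  ⟨PositivityCondition.of_krausCondition hD, OutcomeMIDecay.of_positivityCondition hD,
    fun _ _ hc₀ _ h => MeasuredCMIDecay.of_outcomeMIDecay N hc₀ h⟩
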